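/- **Setting.** All densities, distances and powers are in consistent units. Base stations (BSs) form a homogeneous Poisson point process $\Phi$ of density $\lambda>0$ in the plane; active users (UEs) have density $\rho\in(0,\infty)$; a typical UE is at the origin. BSs without users are idle: as in the standard model of the idle mode, the active BSs form a homogeneous Poisson process $\tilde\Phi\subset\Phi$, obtained from $\Phi$ by independent thinning, of density $$\tilde\lambda=\lambda\Bigl[1-\bigl(1+\tfrac{\rho}{q\lambda}\bigr)^{-q}\Bigr],\qquad q>0 .$$ The antenna height difference is $L$, so that a link of horizontal length $r$ has 3D length $w=\sqrt{r^2+L^2}$. There are $N\ge 1$ path loss pieces with break points $L<d_1<\dots<d_{N-1}$; piece $1$ is $L\le w\le d_1$, piece $n$ is $d_{n-1}<w\le d_n$, piece $N$ is $w>d_{N-1}$. On piece $n$ a link is line-of-sight (LoS) with probability $\mathrm{Pr}^{\rm L}_n(w)\in[0,1]$, non-increasing in $w$ on that piece, with path loss $\zeta^{\rm L}_n(w)=A^{\rm L}_nw^{-\alpha^{\rm L}_n}$, and otherwise non-line-of-sight (NLoS) with path loss $\zeta^{\rm NL}_n(w)=A^{\rm NL}_nw^{-\alpha^{\rm NL}_n}$,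 where all $A_n,\alpha_n>0$. Write $\mathrm{Pr}^{\rm L},\zeta^{\rm L},\zeta^{\rm NL}$ for the functions composed of all pieces. The LoS states of the links (given the positions), the thinning, and the fading gains, which are exponential with mean $1$, are independent of each other and across BSs. The typical UE is served by the BS $b_o\in\Phi$ with the largest path loss function value $\zeta$. With transmit power $P>0$ and noise power $P_{\rm N}\ge 0$, $$\mathrm{SINR}=\frac{P\,\zeta(b_o)\,h}{\sum_{b_i\in\tilde\Phi\setminus b_o}P\,\beta_i\,g_i+P_{\rm N}},\qquad p^{\rm cov}(\lambda,\rho,\gamma)=\Pr[\mathrm{SINR}>\gamma],$$ where $h,g_i$ are the fading gains and $\beta_i$ the path losses of the links. **Theorem (SINR invariance law).** If $L>0$, $0<\rho<\infty$ and $\gamma>0$, then $\lim_{\lambda\to\infty}p^{\rm cov}(\lambda,\rho,\gamma)$ exists and is a constant $c$ (independent of $\lambda$, and of $q$). If moreover LoS links of nearly minimal length are possible ($\mathrm{Pr}^{\rm L}_1(w)>0$ for some $w>L$ in the first piece, which is automatic if $\mathrm{Pr}^{\rm L}_1$ is strictly decreasing) and no link is stronger than an LoS link of minimal length ($\zeta^{\rm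 L}(w)\le\zeta^{\rm L}_1(L)$ and $\zeta^{\rm NL}(w)\le\zeta^{\rm L}_1(L)$ for all $w\ge L$), then, with $s=\gamma/(P\zeta^{\rm L}_1(L))$, $$c=\exp\Bigl(-\frac{P_{\rm N}\gamma}{P\zeta^{\rm L}_1(L)}\Bigr)\exp\Bigl(-2\pi\rho\int_0^\infty\frac{\mathrm{Pr}^{\rm L}(\sqrt{u^2+L^2})\,u}{1+\bigl(sP\zeta^{\rm L}(\sqrt{u^2+L^2})\bigr)^{-1}}\,du\Bigr)\exp\Bigl(-2\pi\rho\int_0^\infty\frac{\bigl[1-\mathrm{Pr}^{\rm L}(\sqrt{u^2+L^2})\bigr]u}{1+\bigl(sP\zeta^{\rm NL}(\sqrt{u^2+L^2})\bigr)^{-1}}\,du\Bigr),$$ where $e^{-\infty}=0$ if an integral diverges. -/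

import Mathlib

open MeasureTheory ProbabilityTheory Filter Topology
open scoped ENNReal NNReal

noncomputable section

namespace CellularNetwork

/-- The plane in which base stations are deployed. -/
abbrev Plane : Type := EuclideanSpace ℝ (Fin 2)

/-! ### Poisson point processes -/

/-- Number of points of the (enumerated) point configuration `X` that lie in `B`. -/
def pointCount {Ω E : Type*} (X : ℕ → Ω → E) (B : Set E) (ω : Ω) : ℕ∞ :=
  Set.encard {i : ℕ | X i ω ∈ B}

/-- The random points `X 0, X 1, …` form a Poisson point process with intensity measure `ν`:
the number of points in a measurable set of finite `ν`-measure is Poisson distributed with mean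
the measure of that set, and the numbers of points in disjoint measurable sets are independent.
(The enumeration by `ℕ` is no restriction if `ν` has infinite total mass.) -/
structure IsPoissonProcess {Ω E : Type*} [MeasurableSpace Ω] [MeasurableSpace E]
    (X : ℕ → Ω → E) (ν : Measure E) (μ : Measure Ω) : Prop where
  measurable : ∀ i, Measurable (X i)
  law : ∀ B : Set E, MeasurableSet B → ν B ≠ ∞ →
    μ.map (pointCount X B) = (poissonMeasure (ν B).toNNReal).map (fun k : ℕ => (k : ℕ∞))
  indep : ∀ (n : ℕ) (B : Fin n → Set E), (∀ k, MeasurableSet (B k)) →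
    Pairwise (fun k l => Disjoint (B k) (B l)) →
    iIndepFun (fun k => pointCount X (B k)) μ

/-! ### Path loss -/

/-- Index of the piece that contains the distance `w`: piece `0` is `w ≤ d 0`, piece `k` is
`d (k - 1) < w ≤ d k`, and the last piece is `d (m - 1) < w`. -/
def pieceIndex {m : ℕ} (d : Fin m → ℝ) (w : ℝ) : Fin (m + 1) :=
  ⟨(Finset.univ.filter (fun k : Fin m => d k < w)).card, by
    have h := Finset.card_le_univ (Finset.univ.filter (fun k : Fin m => d k < w))
    rw [Fintype.card_fin] at h
    omega⟩

/-- A path loss model with `m + 1` pieces for 3D distances `w ≥ L`. On piece `n` a link is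
line-of-sight (LoS) with probability `prL n w`, and has gain `AL n * w ^ (-αL n)` if it is LoS and
`ANL n * w ^ (-αNL n)` if it is non-line-of-sight (NLoS). -/
structure PathLoss (m : ℕ) (L : ℝ) where
  d : Fin m → ℝ
  AL : Fin (m + 1) → ℝ
  ANL : Fin (m + 1) → ℝ
  αL : Fin (m + 1) → ℝ
  αNL : Fin (m + 1) → ℝ
  prL : Fin (m + 1) → ℝ → ℝ
  d_strictMono : StrictMono d
  L_lt_d : ∀ k, L < d k
  AL_pos : ∀ n, 0 < AL n
  ANL_pos : ∀ n, 0 < ANL n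
  αL_pos : ∀ n, 0 < αL n
  αNL_pos : ∀ n, 0 < αNL n
  prL_mem : ∀ n w, L ≤ w → pieceIndex d w = n → prL n w ∈ Set.Icc (0 : ℝ) 1
  prL_antitone : ∀ n, AntitoneOn (prL n) {w | L ≤ w ∧ pieceIndex d w = n}

namespace PathLoss

variable {m : ℕ} {L : ℝ} (M : PathLoss m L)

/-- LoS path loss function of the `n`-th piece. -/
def pieceLoS (n : Fin (m + 1)) (w : ℝ) : ℝ := M.AL n * w ^ (-M.αL n)

/-- NLoS path loss function of the `n`-th piece. -/
def pieceNLoS (n : Fin (m + 1)) (w : ℝ) : ℝ := M.ANL n * w ^ (-M.αNL n)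

/-- The LoS path loss function (all pieces together). -/
def gainLoS (w : ℝ) : ℝ := M.pieceLoS (pieceIndex M.d w) w

/-- The NLoS path loss function (all pieces together). -/
def gainNLoS (w : ℝ) : ℝ := M.pieceNLoS (pieceIndex M.d w) w

/-- The LoS probability function (all pieces together). -/
def probLoS (w : ℝ) : ℝ := M.prL (pieceIndex M.d w) w

end PathLoss

/-- 3D distance of a link with 2D distance `r` and antenna height difference `L`. -/
def dist3D (L r : ℝ) : ℝ := Real.sqrt (r ^ 2 + L ^ 2)

/-! ### The network -/

/-- Density of the active base stations, for base station density `lam`, user density `ρ` and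
parameter `q`: `lam * (1 - 1 / (1 + ρ / (q * lam)) ^ q)`. -/
def activeDensity (q ρ lam : ℝ) : ℝ := lam * (1 - 1 / (1 + ρ / (q * lam)) ^ q)

/-- The random data of the network as seen from the typical user at the origin: for the `i`-th
base station its position `X i`, a number `U i` that decides whether its link to the typical user
is LoS, a number `V i` that decides whether it is active, and the fading gain `g i` of its link to
the typical user. -/
structure Deployment (Ω : Type*) where
  X : ℕ → Ω → Plane
  U : ℕ → Ω → ℝ
  V : ℕ → Ω → ℝ
  g : ℕ → Ω → ℝ

namespace Deployment

variable {Ω : Type*}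

/-- The base stations form a homogeneous Poisson point process of density `lam`. Independently of
their positions they carry independent, identically distributed marks, each consisting of two
numbers that are uniform on `[0, 1]` and of an exponential variable with mean one (Rayleigh
fading), these three being independent. -/
structure IsNetwork [MeasurableSpace Ω] (D : Deployment Ω) (lam : ℝ) (μ : Measure Ω) : Prop where
  poisson : IsPoissonProcess D.X (ENNReal.ofReal lam • (volume : Measure Plane)) μ
  measurable_U : ∀ i, Measurable (D.U i)
  measurable_V : ∀ i, Measurable (D.V i)
  measurable_g : ∀ i, Measurable (D.g i)
  mark_law : ∀ i, μ.map (fun ω => (D.U i ω, D.V i ω, D.g i ω)) =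
    ((volume : Measure ℝ).restrict (Set.Icc 0 1)).prod
      (((volume : Measure ℝ).restrict (Set.Icc 0 1)).prod (expMeasure 1))
  mark_iIndep : iIndepFun (fun i ω => (D.U i ω, D.V i ω, D.g i ω)) μ
  mark_indep : IndepFun (fun ω i => D.X i ω) (fun ω i => (D.U i ω, D.V i ω, D.g i ω)) μ

variable {m : ℕ} {L : ℝ} (D : Deployment Ω) (M : PathLoss m L)

/-- 3D distance between the `i`-th base station and the typical user. -/
def linkDist (_M : PathLoss m L) (i : ℕ) (ω : Ω) : ℝ := dist3D L ‖D.X i ω‖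

open Classical in
/-- Path loss between the `i`-th base station and the typical user. The link is LoS if
`U i ≤ Pr^L(w)`, which given the positions has probability `Pr^L(w)`. -/
def gain (i : ℕ) (ω : Ω) : ℝ :=
  if D.U i ω ≤ M.probLoS (D.linkDist M i ω) then M.gainLoS (D.linkDist M i ω)
  else M.gainNLoS (D.linkDist M i ω)

/-- The serving base station: the one with the largest path loss function value, that is, with the
largest average received power. (Almost surely there is exactly one.) -/
def serving (ω : Ω) : ℕ := sInf {i : ℕ | ∀ j, D.gain M j ω ≤ D.gain M i ω}

/-- The `i`-th base station is active. Since the `V i` are independent and uniform on `[0, 1]`, the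
active base stations are an independent thinning of all base stations, that is, a homogeneous
Poisson point process of density `activeDensity q ρ lam`. -/
def IsActive (q ρ lam : ℝ) (i : ℕ) (ω : Ω) : Prop := D.V i ω ≤ activeDensity q ρ lam / lam

open Classical in
/-- Aggregate interference: the total power received from all active base stations except the
serving one (possibly infinite). -/
def interference (P q ρ lam : ℝ) (ω : Ω) : ℝ≥0∞ :=
  ∑' i : ℕ, if i ≠ D.serving M ω ∧ D.IsActive q ρ lam i ω then
    ENNReal.ofReal (P * D.gain M i ω * D.g i ω) else 0

/-- Signal-to-interference-plus-noise ratio of the typical user. -/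
def sinr (P PN q ρ lam : ℝ) (ω : Ω) : ℝ≥0∞ :=
  ENNReal.ofReal (P * D.gain M (D.serving M ω) ω * D.g (D.serving M ω) ω) /
    (D.interference M P q ρ lam ω + ENNReal.ofReal PN)

/-- Coverage probability: the probability that the SINR exceeds the threshold `γ`. -/
def coverage [MeasurableSpace Ω] (μ : Measure Ω) (P PN q ρ γ lam : ℝ) : ℝ≥0∞ :=
  μ {ω | ENNReal.ofReal γ < D.sinr M P PN q ρ lam ω}

end Deployment

/-! ### The limit formula -/

namespace PathLoss

variable {m : ℕ} {L : ℝ} (M : PathLoss m L)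

/-- `∫₀^∞ Pr^L(w) u / (1 + (s P ζ^L(w))⁻¹) du` with `w = √(u² + L²)`. -/
def integralLoS (P s : ℝ) : ℝ≥0∞ :=
  ∫⁻ u in Set.Ioi (0 : ℝ), ENNReal.ofReal
    (M.probLoS (dist3D L u) * u / (1 + (s * P * M.gainLoS (dist3D L u))⁻¹))

/-- `∫₀^∞ (1 - Pr^L(w)) u / (1 + (s P ζ^NL(w))⁻¹) du` with `w = √(u² + L²)`. -/
def integralNLoS (P s : ℝ) : ℝ≥0∞ :=
  ∫⁻ u in Set.Ioi (0 : ℝ), ENNReal.ofReal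
    ((1 - M.probLoS (dist3D L u)) * u / (1 + (s * P * M.gainNLoS (dist3D L u))⁻¹))

/-- Limit of the Laplace transform of the interference,
`exp (-2πρ ∫ …) * exp (-2πρ ∫ …)`, where `exp (-∞) = 0`. -/
def laplaceLimit (P ρ s : ℝ) : ℝ≥0∞ :=
  EReal.exp (-((ENNReal.ofReal (2 * Real.pi * ρ) * M.integralLoS P s : ℝ≥0∞) : EReal)) *
    EReal.exp (-((ENNReal.ofReal (2 * Real.pi * ρ) * M.integralNLoS P s : ℝ≥0∞) : EReal))

/-- The limit formula of the coverage probability. -/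
def coverageLimit (P PN ρ γ : ℝ) : ℝ≥0∞ :=
  ENNReal.ofReal (Real.exp (-(PN * γ / (P * M.pieceLoS 0 L)))) *
    M.laplaceLimit P ρ (γ / (P * M.pieceLoS 0 L))

end PathLoss

end CellularNetwork

end

noncomputable section

namespace CellularNetwork

/-! Fix positions and LoS marks, so that all path losses `z i` are known, and let `k` be the serving
index. Integrating out activity and Rayleigh fading (`measure_coverSet`) gives a noise term `exp
(-PN γ / (P z k))` times the product over `i ≠ k` of `1 - p γ z i / (z k + γ z i)`, where `p` is the
activity probability. If `z k` were a constant `t` and the product ran over all `i`, the Laplace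
functional of the Poisson process would turn its mean into `exp (-lam p J(t))`, with `J` the
`interferenceIntegral`. Here `lam p` tends to `ρ`: only the users limit the number of interferers.

The server is random and depends on the whole process, but the expression is monotone in `z k`. Let
`Z = maxGain` be the essential supremum of the link gain. From above, `z k ≤ Z` almost surely, and
the missing factor at `k` costs a constant that tends to 1, since `p → 0`. From below, for `t < Z`,
the server has gain at least `t` unless no link does, which has probability `exp (-lam |{gain ≥ t}|)
→ 0`. Letting `t` increase to `Z` closes the gap, so `c = exp (-PN γ / (P Z)) exp (-ρ J(Z))`. Under
the additional hypotheses `Z` is the LoS gain at distance `L`, and polar coordinates convert `J(Z)`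
into the stated integrals. Sums and exponents live in `[0, ∞]`, so divergent interference is
covered. -/

/-- `exp (-a)` for an extended nonnegative real `a`, with `exp (-∞) = 0`. -/
def expNeg (a : ℝ≥0∞) : ℝ≥0∞ := EReal.exp (-(a : EReal))

lemma expNeg_add (a b : ℝ≥0∞) : expNeg (a + b) = expNeg a * expNeg b := by
  unfold expNeg
  rw [← EReal.exp_add, EReal.coe_ennreal_add, EReal.neg_add, sub_eq_add_neg]
  · left; exact EReal.coe_ennreal_ne_bot _
  · right; exact EReal.coe_ennreal_ne_bot _

lemma expNeg_ofReal {r : ℝ} (hr : 0 ≤ r) :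
    expNeg (ENNReal.ofReal r) = ENNReal.ofReal (Real.exp (-r)) := by
  rw [expNeg, EReal.coe_ennreal_ofReal, max_eq_left hr, ← EReal.coe_neg, EReal.exp_coe]

@[simp] lemma expNeg_zero : expNeg 0 = 1 := by simp [expNeg]

@[simp] lemma expNeg_top : expNeg ∞ = 0 := by simp [expNeg]

lemma expNeg_antitone : Antitone expNeg := fun _ _ h =>
  EReal.exp_monotone (EReal.neg_le_neg_iff.2 (EReal.coe_ennreal_le_coe_ennreal_iff.2 h))

lemma expNeg_le_one (a : ℝ≥0∞) : expNeg a ≤ 1 :=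
  (expNeg_antitone zero_le).trans_eq expNeg_zero

lemma continuous_expNeg : Continuous expNeg :=
  ENNReal.continuous_exp.comp (continuous_neg.comp continuous_coe_ennreal_ereal)

lemma measurable_expNeg : Measurable expNeg := continuous_expNeg.measurable

lemma expNeg_sum {ι : Type*} (s : Finset ι) (a : ι → ℝ≥0∞) :
    expNeg (∑ i ∈ s, a i) = ∏ i ∈ s, expNeg (a i) := by
  classical
  induction s using Finset.induction_on with
  | empty => simp
  | insert i s hi ih => rw [Finset.sum_insert hi, Finset.prod_insert hi, expNeg_add, ih]

/-! ### Infinite products of factors in `[0, 1]`. -/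

/-- The infimum of the partial products, which is their limit if all factors are at most one. -/
def infProd (f : ℕ → ℝ≥0∞) : ℝ≥0∞ := ⨅ n, ∏ i ∈ Finset.range n, f i

lemma infProd_mono {f g : ℕ → ℝ≥0∞} (h : ∀ i, f i ≤ g i) : infProd f ≤ infProd g :=
  iInf_mono fun _ => Finset.prod_le_prod' fun i _ => h i

lemma antitone_prod_range {f : ℕ → ℝ≥0∞} (hf : ∀ i, f i ≤ 1) :
    Antitone fun n => ∏ i ∈ Finset.range n, f i :=
  antitone_nat_of_succ_le fun n => by
    rw [Finset.prod_range_succ]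
    exact mul_le_of_le_one_right' (hf n)

lemma infProd_le_one (f : ℕ → ℝ≥0∞) : infProd f ≤ 1 :=
  (iInf_le _ 0).trans (by simp)

lemma tendsto_infProd {f : ℕ → ℝ≥0∞} (hf : ∀ i, f i ≤ 1) :
    Tendsto (fun n => ∏ i ∈ Finset.range n, f i) atTop (𝓝 (infProd f)) :=
  tendsto_atTop_iInf (antitone_prod_range hf)

lemma infProd_mul {f g : ℕ → ℝ≥0∞} (hf : ∀ i, f i ≤ 1) (hg : ∀ i, g i ≤ 1) :
    infProd (fun i => f i * g i) = infProd f * infProd g := by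
  have h1 := tendsto_infProd (f := fun i => f i * g i) fun i => mul_le_one' (hf i) (hg i)
  refine tendsto_nhds_unique h1 ?_
  simp only [Finset.prod_mul_distrib]
  exact ENNReal.Tendsto.mul (tendsto_infProd hf)
    (Or.inr (ne_top_of_le_ne_top ENNReal.one_ne_top (infProd_le_one g))) (tendsto_infProd hg)
    (Or.inr (ne_top_of_le_ne_top ENNReal.one_ne_top (infProd_le_one f)))

lemma infProd_one : infProd (fun _ => 1) = 1 := by simp [infProd]

lemma infProd_finset_prod {ι : Type*} (s : Finset ι) {f : ι → ℕ → ℝ≥0∞} (hf : ∀ c i, f c i ≤ 1) :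
    infProd (fun i => ∏ c ∈ s, f c i) = ∏ c ∈ s, infProd (f c) := by
  classical
  induction s using Finset.induction_on with
  | empty => simp [infProd_one]
  | insert c s hc ih =>
    simp only [Finset.prod_insert hc]
    rw [infProd_mul (hf c) (fun i => Finset.prod_le_one' fun c _ => hf c i), ih]

/-- The two infima commute, and a finite product of bounded factors passes to the decreasing limit.
This carries the Laplace functional from simple functions to measurable ones. -/
lemma infProd_iInf {f : ℕ → ℕ → ℝ≥0∞} (hanti : ∀ i, Antitone fun k => f k i)
    (hf : ∀ k i, f k i ≤ 1) :
    infProd (fun i => ⨅ k, f k i) = ⨅ k, infProd (f k) := by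
  unfold infProd
  rw [iInf_comm]
  congr 1; ext n
  refine tendsto_nhds_unique (f := fun k => ∏ i ∈ Finset.range n, f k i) (l := atTop) ?_
    (tendsto_atTop_iInf fun k l h => Finset.prod_le_prod' fun i _ => hanti i h)
  have h1 : ∀ i, Tendsto (fun k => f k i) atTop (𝓝 (⨅ k, f k i)) := fun i =>
    tendsto_atTop_iInf (hanti i)
  have hle : ∀ i, (⨅ k, f k i) ≤ 1 := fun i => (iInf_le _ 0).trans (hf 0 i)
  have : ∀ n, Tendsto (fun k => ∏ i ∈ Finset.range n, f k i) atTop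
      (𝓝 (∏ i ∈ Finset.range n, ⨅ k, f k i)) := by
    intro n
    induction n with
    | zero => simp
    | succ n ih =>
      simp only [Finset.prod_range_succ]
      exact ENNReal.Tendsto.mul ih (Or.inr (ne_top_of_le_ne_top ENNReal.one_ne_top (hle n)))
        (h1 n) (Or.inr (ne_top_of_le_ne_top ENNReal.one_ne_top
          (Finset.prod_le_one' fun i _ => hle i)))
  exact this n

/-- No summability is needed: if the series diverges, both sides are zero. This is how the total
interference becomes a product over base stations. -/
lemma expNeg_tsum (a : ℕ → ℝ≥0∞) : expNeg (∑' i, a i) = infProd fun i => expNeg (a i) := by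
  refine tendsto_nhds_unique (f := fun n => ∏ i ∈ Finset.range n, expNeg (a i)) (l := atTop) ?_
    (tendsto_infProd fun i => expNeg_le_one _)
  simp only [← expNeg_sum]
  exact (continuous_expNeg.tendsto _).comp ENNReal.summable.hasSum.tendsto_sum_nat

@[fun_prop]
lemma Measurable.infProd {α : Type*} [MeasurableSpace α] {f : ℕ → α → ℝ≥0∞}
    (hf : ∀ i, Measurable (f i)) : Measurable fun a => infProd fun i => f i a :=
  Measurable.iInf fun _ => Finset.measurable_fun_prod _ fun i _ => hf i

lemma lintegral_infProd {α : Type*} [MeasurableSpace α] {μ : Measure α} [IsFiniteMeasure μ]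
    {f : ℕ → α → ℝ≥0∞} (hm : ∀ i, Measurable (f i)) (hf : ∀ i a, f i a ≤ 1) :
    ∫⁻ a, infProd (fun i => f i a) ∂μ = ⨅ n, ∫⁻ a, ∏ i ∈ Finset.range n, f i a ∂μ := by
  refine lintegral_iInf (fun n => Finset.measurable_fun_prod _ fun i _ => hm i)
    (fun m n h a => antitone_prod_range (fun i => hf i a) h) (by simp)

/-- Expectation of an infinite product of functions of independent coordinates. -/
lemma lintegral_infProd_infinitePi {α : Type*} [MeasurableSpace α] (ν : Measure α)
    [IsProbabilityMeasure ν] {f : ℕ → α → ℝ≥0∞} (hm : ∀ i, Measurable (f i))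
    (hf : ∀ i a, f i a ≤ 1) :
    ∫⁻ w, infProd (fun i => f i (w i)) ∂(Measure.infinitePi fun _ : ℕ => ν) =
      infProd fun i => ∫⁻ a, f i a ∂ν := by
  rw [lintegral_infProd (fun i => by fun_prop) fun i w => hf i _]
  unfold infProd
  congr 1; ext n
  rw [lintegral_prod_eq_prod_lintegral_of_indepFun _ (fun i (w : ℕ → α) => f i (w i))
    (iIndepFun_infinitePi fun i => hm i) (fun i => by fun_prop)]
  refine Finset.prod_congr rfl fun i _ => ?_
  exact (measurePreserving_eval_infinitePi (fun _ : ℕ => ν) i).lintegral_comp (hm i)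

/-! ### The Laplace functional of a Poisson process -/

/-- Writes the count as a supremum of finite sums of indicators, from which its measurability
follows. -/
lemma pointCount_eq_iSup {Ω E : Type*} (X : ℕ → Ω → E) (B : Set E) (ω : Ω) [DecidablePred fun i => X i ω ∈ B] :
    pointCount X B ω = ⨆ n : ℕ, (((Finset.range n).filter fun i => X i ω ∈ B).card : ℕ∞) := by
  refine le_antisymm ?_ (iSup_le fun n => ?_)
  · refine ENat.forall_natCast_le_iff_le.1 fun k hk => ?_
    obtain ⟨t, ht, htk⟩ := Set.exists_subset_encard_eq hk
    have hfin : t.Finite := Set.finite_of_encard_eq_coe htk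
    lift t to Finset ℕ using hfin
    refine le_iSup_of_le (t.sup id + 1) ?_
    rw [← htk, Set.encard_coe_eq_coe_finsetCard]
    refine Nat.cast_le.2 (Finset.card_le_card fun i hi => ?_)
    refine Finset.mem_filter.2 ⟨Finset.mem_range.2 (Nat.lt_succ_of_le ?_), ht hi⟩
    exact Finset.le_sup (f := id) hi
  · rw [← Set.encard_coe_eq_coe_finsetCard]
    exact Set.encard_le_encard fun i hi => (Finset.mem_filter.1 hi).2

section Poisson

variable {Ω E : Type*} [MeasurableSpace Ω] [MeasurableSpace E] {X : ℕ → Ω → E} {ν : Measure E}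
  {μ : Measure Ω}

lemma borelSpace_enat : BorelSpace ℕ∞ := by
  refine ⟨le_antisymm (fun s _ => ?_) le_top⟩
  let _ : MeasurableSpace ℕ∞ := borel ℕ∞
  have : BorelSpace ℕ∞ := ⟨rfl⟩
  exact (Set.to_countable s).measurableSet

lemma measurable_pointCount (hX : ∀ i, Measurable (X i)) {B : Set E} (hB : MeasurableSet B) :
    Measurable (pointCount X B) := by
  classical
  have := borelSpace_enat
  have : pointCount X B = fun ω =>
      ⨆ n : ℕ, (∑ i ∈ Finset.range n, B.indicator (fun _ => (1 : ℕ∞)) (X i ω)) := by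
    ext ω
    rw [pointCount_eq_iSup]
    congr 1; ext n
    rw [Finset.card_filter]
    push_cast
    rfl
  rw [this]
  refine Measurable.iSup fun n => Finset.measurable_fun_sum _ fun i _ => ?_
  exact (measurable_const.indicator hB).comp (hX i)

/-- The partial products are constant beyond the last index satisfying `x`. -/
lemma infProd_ite_pow {x : ℕ → Prop} [DecidablePred x] {a : ℝ≥0∞} (ha : a ≤ 1)
    (hfin : {i | x i}.Finite) :
    infProd (fun i => if x i then a else 1) = a ^ {i | x i}.ncard := by
  refine tendsto_nhds_unique (tendsto_infProd fun i => by split_ifs <;> simp [ha]) ?_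
  refine tendsto_const_nhds.congr' ?_
  filter_upwards [eventually_ge_atTop (hfin.toFinset.sup id + 1)] with n hn
  rw [Finset.prod_ite, Finset.prod_const, Finset.prod_const_one, mul_one,
    Set.ncard_eq_toFinset_card _ hfin]
  congr 2
  ext i
  simp only [Set.Finite.mem_toFinset, Set.mem_ofPred_eq, Finset.mem_filter, Finset.mem_range,
    iff_and_self]
  intro hi
  have : i ≤ hfin.toFinset.sup id := Finset.le_sup (f := id) (by simpa using hi)
  omega

/-- Generating function of the Poisson distribution. -/
lemma lintegral_pow_poissonMeasure (r : ℝ≥0) {c : ℝ≥0∞} (hc : c ≤ 1) :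
    ∫⁻ n, (1 - c) ^ n ∂(poissonMeasure r) = expNeg (r * c) := by
  have hctop : c ≠ ∞ := ne_top_of_le_ne_top ENNReal.one_ne_top hc
  lift c to ℝ≥0 using hctop
  have hc' : (c : ℝ) ≤ 1 := by exact_mod_cast hc
  have h1 : (1 : ℝ≥0∞) - c = ENNReal.ofReal (1 - c) := by
    rw [ENNReal.ofReal_sub (1 : ℝ) c.coe_nonneg]; simp
  have h2 : (r : ℝ≥0∞) * c = ENNReal.ofReal (r * c) := by
    rw [ENNReal.ofReal_mul (p := (r : ℝ)) r.2]; simp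
  rw [h1, h2, expNeg_ofReal (by positivity), poissonMeasure, lintegral_sum_measure]
  simp only [lintegral_smul_measure, lintegral_dirac]
  have h3 := (NormedSpace.expSeries_div_hasSum_exp ((r : ℝ) * (1 - c))).mul_left (Real.exp (-r))
  rw [← Real.exp_eq_exp_ℝ, ← Real.exp_add] at h3
  have h0 : (0 : ℝ) ≤ 1 - c := by linarith
  rw [show -((r : ℝ) * c) = -r + r * (1 - c) by ring, ← h3.tsum_eq,
    ENNReal.ofReal_tsum_of_nonneg (fun n => by positivity) h3.summable]
  refine tsum_congr fun n => ?_
  rw [smul_eq_mul, ← ENNReal.ofReal_pow h0, ← ENNReal.ofReal_mul (by positivity)]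
  congr 1
  rw [mul_pow]; ring

lemma IsPoissonProcess.ae_pointCount_lt_top (hX : IsPoissonProcess X ν μ) {B : Set E}
    (hB : MeasurableSet B) (hν : ν B ≠ ∞) : ∀ᵐ ω ∂μ, pointCount X B ω < ⊤ := by
  have h : ∀ᵐ n ∂(μ.map (pointCount X B)), n < ⊤ := by
    rw [hX.law B hB hν, ae_map_iff (by fun_prop) (MeasurableSet.of_discrete)]
    exact ae_of_all _ fun n => ENat.natCast_lt_top n
  exact ae_of_ae_map (measurable_pointCount hX.measurable hB).aemeasurable h

/-- Grouping the points by the value `c` of `φ` gives the product of `(1 - c) ^ N c`. The counts `N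
c` of the disjoint level sets are independent and Poisson, so each factor has mean `exp (-c ν {φ =
c})`. The value `0`, whose level set may have infinite measure, contributes only factors 1 and is
dropped. -/
lemma IsPoissonProcess.lintegral_simpleFunc (hX : IsPoissonProcess X ν μ)
    (φ : SimpleFunc E ℝ≥0∞) (hφ : ∀ x, φ x ≤ 1) (hfin : ∀ c, c ≠ 0 → ν (φ ⁻¹' {c}) ≠ ∞) :
    ∫⁻ ω, infProd (fun i => 1 - φ (X i ω)) ∂μ = expNeg (∫⁻ x, φ x ∂ν) := by
  classical
  set s : Finset ℝ≥0∞ := φ.range.filter (· ≠ 0) with hs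
  have hs1 : ∀ c ∈ s, c ≤ 1 := by
    intro c hc
    obtain ⟨x, rfl⟩ := SimpleFunc.mem_range.1 (Finset.mem_filter.1 hc).1
    exact hφ x
  have hs0 : ∀ c ∈ s, c ≠ 0 := fun c hc => (Finset.mem_filter.1 hc).2
  have hprod : ∀ x, 1 - φ x = ∏ c ∈ s, if φ x = c then 1 - c else 1 := by
    intro x
    rw [Finset.prod_ite_eq]
    split_ifs with h
    · rfl
    · have : φ x = 0 := by
        by_contra h0
        exact h (Finset.mem_filter.2 ⟨SimpleFunc.mem_range_self φ x, h0⟩)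
      simp [this]
  let N : s → Ω → ℕ∞ := fun c => pointCount X (φ ⁻¹' {(c : ℝ≥0∞)})
  -- `toNat` sends `⊤` to `0`; this is harmless because the counts are almost surely finite.
  let G : s → ℕ∞ → ℝ≥0∞ := fun c n => (1 - (c : ℝ≥0∞)) ^ n.toNat
  have hind : iIndepFun N μ := by
    let e := Fintype.equivFin s
    have := hX.indep (Fintype.card s) (fun k => φ ⁻¹' {((e.symm k : s) : ℝ≥0∞)})
      (fun k => φ.measurableSet_fiber _) (by
        intro k l hkl
        refine Disjoint.preimage _ (Set.disjoint_singleton.2 fun h => hkl ?_)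
        exact e.symm.injective (Subtype.ext h))
    have h2 := this.precomp e.injective
    simpa [N] using h2
  have hNm : ∀ c, Measurable (N c) := fun c =>
    measurable_pointCount hX.measurable (φ.measurableSet_fiber _)
  have hGm : ∀ c, Measurable (G c) := fun c => measurable_from_top
  have hae : ∀ᵐ ω ∂μ, infProd (fun i => 1 - φ (X i ω)) = ∏ c, G c (N c ω) := by
    have : ∀ᵐ ω ∂μ, ∀ c : s, N c ω < ⊤ := ae_all_iff.2 fun c =>
      hX.ae_pointCount_lt_top (φ.measurableSet_fiber _) (hfin c (hs0 c c.2))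
    filter_upwards [this] with ω hω
    simp only [hprod]
    simp only [← Finset.prod_coe_sort s]
    rw [infProd_finset_prod _ (by intro c i; split_ifs <;> simp)]
    refine Finset.prod_congr rfl fun c _ => ?_
    have hc := hω c
    have hc' : {i | φ (X i ω) = c}.Finite := Set.encard_lt_top_iff.1 hc
    rw [infProd_ite_pow tsub_le_self hc']
    rfl
  rw [lintegral_congr_ae hae, lintegral_prod_eq_prod_lintegral_of_indepFun _
    (fun c ω => G c (N c ω)) (hind.comp G hGm) (fun c => (hGm c).comp (hNm c))]
  rw [SimpleFunc.lintegral_eq_lintegral φ ν, SimpleFunc.lintegral]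
  have hsum : ∑ c ∈ φ.range, c * ν (φ ⁻¹' {c}) = ∑ c : s, (c : ℝ≥0∞) * ν (φ ⁻¹' {(c : ℝ≥0∞)}) := by
    rw [Finset.sum_coe_sort s (fun c => c * ν (φ ⁻¹' {c})), hs]
    refine (Finset.sum_filter_of_ne fun c _ h => ?_).symm
    rintro rfl
    simp at h
  rw [hsum, expNeg_sum]
  refine Finset.prod_congr rfl fun c _ => ?_
  rw [← lintegral_map (hGm c) (hNm c), hX.law _ (φ.measurableSet_fiber _) (hfin c (hs0 c c.2)),
    lintegral_map (hGm c) (by fun_prop)]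
  have := lintegral_pow_poissonMeasure (ν (φ ⁻¹' {(c : ℝ≥0∞)})).toNNReal (hs1 c c.2)
  rw [ENNReal.coe_toNNReal (hfin c (hs0 c c.2)), mul_comm] at this
  simpa [G] using this

/-- The Laplace functional of a Poisson process. -/
theorem IsPoissonProcess.lintegral_infProd [SigmaFinite ν] [IsFiniteMeasure μ]
    (hX : IsPoissonProcess X ν μ) {F : E → ℝ≥0∞} (hFm : Measurable F) (hF : ∀ x, F x ≤ 1) :
    ∫⁻ ω, infProd (fun i => F (X i ω)) ∂μ = expNeg (∫⁻ x, (1 - F x) ∂ν) := by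
  have hGm : Measurable fun x => 1 - F x := measurable_const.sub hFm
  -- Simple functions increasing to `1 - F`, cut off to sets of finite measure so that their nonzero
  -- level sets have finite measure.
  let φ : ℕ → SimpleFunc E ℝ≥0∞ := fun n =>
    (SimpleFunc.eapprox (fun x => 1 - F x) n).restrict (spanningSets ν n)
  have hφ : ∀ n x, φ n x = (spanningSets ν n).indicator
      (SimpleFunc.eapprox (fun x => 1 - F x) n) x := fun n x => by
    simp only [φ]
    rw [SimpleFunc.restrict_apply _ (measurableSet_spanningSets ν n)]
  have hmono : Monotone fun n => (φ n : E → ℝ≥0∞) := by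
    intro m n hmn x
    simp only [hφ]
    refine Set.indicator_le_indicator_of_subset (monotone_spanningSets ν hmn)
      (fun _ => zero_le) x |>.trans ?_
    exact Set.indicator_le_indicator (SimpleFunc.monotone_eapprox _ hmn x)
  have hsup : ∀ x, ⨆ n, φ n x = 1 - F x := by
    intro x
    refine le_antisymm (iSup_le fun n => ?_) ?_
    · rw [hφ]
      refine (Set.indicator_le_self' (fun _ _ => zero_le) x).trans ?_
      rw [← SimpleFunc.iSup_eapprox_apply hGm x]
      exact le_iSup (fun n => SimpleFunc.eapprox (fun x => 1 - F x) n x) n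
    · rw [← SimpleFunc.iSup_eapprox_apply hGm x]
      refine iSup_le fun n => ?_
      refine le_iSup_of_le (max n (spanningSetsIndex ν x)) ?_
      rw [hφ, Set.indicator_of_mem]
      · exact SimpleFunc.monotone_eapprox _ (le_max_left _ _) x
      · exact monotone_spanningSets ν (le_max_right _ _) (mem_spanningSetsIndex ν x)
  have hφ1 : ∀ n x, φ n x ≤ 1 := fun n x =>
    (le_iSup (fun n => φ n x) n).trans (by rw [hsup]; exact tsub_le_self)
  have hF' : ∀ x, F x = ⨅ n, (1 - φ n x) := by
    intro x
    rw [← ENNReal.sub_iSup ENNReal.one_ne_top, hsup, ENNReal.sub_sub_cancel ENNReal.one_ne_top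
      (hF x)]
  have hanti : ∀ x, Antitone fun n => 1 - φ n x := fun x m n h =>
    tsub_le_tsub_left (hmono h x) 1
  have hfin : ∀ n c, c ≠ 0 → ν (φ n ⁻¹' {c}) ≠ ∞ := by
    intro n c hc
    refine ne_top_of_le_ne_top (measure_spanningSets_lt_top ν n).ne (measure_mono fun x hx => ?_)
    by_contra hx'
    apply hc
    have : φ n x = c := hx
    rw [← this, hφ, Set.indicator_of_notMem hx']
  have key : ∀ n, ∫⁻ ω, infProd (fun i => 1 - φ n (X i ω)) ∂μ = expNeg (∫⁻ x, φ n x ∂ν) :=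
    fun n => hX.lintegral_simpleFunc (φ n) (hφ1 n) (hfin n)
  have h1 : ∀ ω, infProd (fun i => F (X i ω)) = ⨅ n, infProd (fun i => 1 - φ n (X i ω)) := by
    intro ω
    simp only [hF']
    exact infProd_iInf (fun i => hanti _) (fun _ _ => tsub_le_self)
  simp only [h1]
  rw [lintegral_iInf]
  · simp only [key]
    have h2 : ∫⁻ x, (1 - F x) ∂ν = ⨆ n, ∫⁻ x, φ n x ∂ν := by
      rw [← lintegral_iSup (fun n => (φ n).measurable) hmono]
      simp only [hsup]
    rw [h2]
    have hm2 : Monotone fun n => ∫⁻ x, φ n x ∂ν := fun m n h => lintegral_mono (hmono h)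
    exact tendsto_nhds_unique (tendsto_atTop_iInf fun m n h => expNeg_antitone (hm2 h))
      ((continuous_expNeg.tendsto _).comp (tendsto_atTop_iSup hm2))
  · intro n
    refine Measurable.infProd fun i => ?_
    exact measurable_const.sub ((φ n).measurable.comp (hX.measurable i))
  · intro m n h ω
    exact infProd_mono fun i => hanti _ h
  · refine ne_top_of_le_ne_top (measure_ne_top μ Set.univ) ?_
    refine (lintegral_mono fun ω => infProd_le_one _).trans ?_
    simp

end Poisson

/-! ### Infinite products of probability measures -/

section InfiniteProduct

variable {α β : Type*} [MeasurableSpace α] [MeasurableSpace β]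

/-- A sequence of independent pairs with independent components is a pair of independent
sequences. -/
lemma map_prod_infinitePi (ν₁ : Measure α) (ν₂ : Measure β) [IsProbabilityMeasure ν₁]
    [IsProbabilityMeasure ν₂] :
    ((Measure.infinitePi fun _ : ℕ => ν₁).prod (Measure.infinitePi fun _ : ℕ => ν₂)).map
      (fun p i => (p.1 i, p.2 i)) = Measure.infinitePi fun _ : ℕ => ν₁.prod ν₂ := by
  -- A product measure is determined by finite-dimensional boxes, where Fubini applies
  -- coordinatewise.
  refine Measure.eq_infinitePi _ fun s t ht => ?_
  have hs : MeasurableSet (Set.pi (s : Set ℕ) t) := .pi s.countable_toSet fun i _ => ht i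
  rw [Measure.map_apply (by fun_prop) hs, Measure.prod_apply (hs.preimage (by fun_prop))]
  have h1 : ∀ u : ℕ → α, (Measure.infinitePi fun _ : ℕ => ν₂)
      (Prod.mk u ⁻¹' ((fun (p : (ℕ → α) × (ℕ → β)) i => (p.1 i, p.2 i)) ⁻¹' Set.pi s t)) =
      ∏ i ∈ s, ν₂ (Prod.mk (u i) ⁻¹' t i) := fun u =>
    Measure.infinitePi_pi (fun _ : ℕ => ν₂) (t := fun i => Prod.mk (u i) ⁻¹' t i)
      fun i _ => (ht i).preimage (by fun_prop)
  simp only [h1]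
  have hm : ∀ i, Measurable fun a => ν₂ (Prod.mk a ⁻¹' t i) := fun i =>
    measurable_measure_prodMk_left (ht i)
  rw [lintegral_prod_eq_prod_lintegral_of_indepFun s
    (fun i (u : ℕ → α) => ν₂ (Prod.mk (u i) ⁻¹' t i))
    (iIndepFun_infinitePi hm) (fun i => (hm i).comp (measurable_pi_apply i))]
  refine Finset.prod_congr rfl fun i _ => ?_
  rw [Measure.prod_apply (ht i)]
  exact (measurePreserving_eval_infinitePi (fun _ : ℕ => ν₁) i).lintegral_comp (hm i)

/-- Replacing one coordinate by an independent copy does not change the law. -/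
lemma map_update_infinitePi (ν : Measure α) [IsProbabilityMeasure ν] (k : ℕ) :
    (ν.prod (Measure.infinitePi fun _ : ℕ => ν)).map (fun p => Function.update p.2 k p.1) =
      Measure.infinitePi fun _ : ℕ => ν := by
  classical
  have hmeas : Measurable fun p : α × (ℕ → α) => Function.update p.2 k p.1 := by
    refine measurable_pi_iff.2 fun i => ?_
    by_cases h : i = k
    · subst h; simpa using measurable_fst
    · simp only [Function.update_of_ne h]; fun_prop
  refine Measure.eq_infinitePi _ fun s t ht => ?_
  have hs : MeasurableSet (Set.pi (s : Set ℕ) t) := .pi s.countable_toSet fun i _ => ht i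
  rw [Measure.map_apply hmeas hs]
  have h1 : (fun p : α × (ℕ → α) => Function.update p.2 k p.1) ⁻¹' Set.pi s t =
      (if k ∈ s then t k else Set.univ) ×ˢ Set.pi ((s.erase k : Finset ℕ) : Set ℕ) t := by
    ext ⟨a, w⟩
    simp only [Set.mem_preimage, Set.mem_pi, Set.mem_prod, Finset.mem_coe, Finset.mem_erase]
    constructor
    · intro h
      refine ⟨?_, fun i hi => by simpa [Function.update_of_ne hi.1] using h i hi.2⟩
      split_ifs with hk
      · simpa using h k hk
      · trivial
    · rintro ⟨h, h'⟩ i hi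
      by_cases hik : i = k
      · subst hik; simpa [hi] using h
      · simpa [Function.update_of_ne hik] using h' i ⟨hik, hi⟩
  rw [h1, Measure.prod_prod, Measure.infinitePi_pi _ fun i _ => ht i]
  split_ifs with hk
  · exact Finset.mul_prod_erase s (fun i => ν (t i)) hk
  · rw [measure_univ, one_mul, Finset.erase_eq_of_notMem hk]

/-- Allows the marks of the serving station to be integrated first, with all other marks frozen. -/
lemma lintegral_infinitePi_update (ν : Measure α) [IsProbabilityMeasure ν] (k : ℕ)
    {f : (ℕ → α) → ℝ≥0∞} (hf : Measurable f) :
    ∫⁻ w, f w ∂(Measure.infinitePi fun _ : ℕ => ν) =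
      ∫⁻ w, ∫⁻ a, f (Function.update w k a) ∂ν ∂(Measure.infinitePi fun _ : ℕ => ν) := by
  have hmeas : Measurable fun p : α × (ℕ → α) => Function.update p.2 k p.1 := by
    refine measurable_pi_iff.2 fun i => ?_
    by_cases h : i = k
    · subst h; simpa using measurable_fst
    · simp only [Function.update_of_ne h]; fun_prop
  conv_lhs => rw [← map_update_infinitePi ν k]
  rw [lintegral_map hf hmeas]
  exact lintegral_prod_symm' _ (hf.comp hmeas)

end InfiniteProduct

/-! ### Exponential and uniform variables -/

instance : IsProbabilityMeasure (expMeasure 1) := isProbabilityMeasure_expMeasure one_pos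

/-- The uniform distribution on `[0, 1]`. -/
def unif : Measure ℝ := (volume : Measure ℝ).restrict (Set.Icc 0 1)

instance : IsProbabilityMeasure unif := ⟨by simp [unif]⟩

lemma unif_Iic {p : ℝ} (h1 : p ≤ 1) : unif (Set.Iic p) = ENNReal.ofReal p := by
  rw [unif, Measure.restrict_apply measurableSet_Iic]
  have : Set.Iic p ∩ Set.Icc 0 1 = Set.Icc 0 p := by
    ext x; simp only [Set.mem_inter_iff, Set.mem_Iic, Set.mem_Icc]
    constructor
    · rintro ⟨a, b, c⟩; exact ⟨b, a⟩
    · rintro ⟨a, b⟩; exact ⟨b, a, b.trans h1⟩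
  rw [this, Real.volume_Icc, sub_zero]

lemma expMeasure_Ioi {x : ℝ} (hx : 0 ≤ x) :
    expMeasure 1 (Set.Ioi x) = ENNReal.ofReal (Real.exp (-x)) := by
  have h := cdf_expMeasure_eq (one_pos : (0 : ℝ) < 1) x
  rw [if_pos hx, cdf_eq_real, one_mul] at h
  rw [← Set.compl_Iic, prob_compl_eq_one_sub measurableSet_Iic, ← ofReal_measureReal, h,
    ← ENNReal.ofReal_one, ← ENNReal.ofReal_sub _ (by
      have := Real.exp_le_one_iff.2 (neg_nonpos.2 hx); linarith)]
  congr 1; ring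

/-- Tail of a scaled exponential variable. -/
lemma expMeasure_lt_mul {γ c : ℝ} (hγ : 0 < γ) (hc : 0 < c) (b : ℝ≥0∞) :
    expMeasure 1 {a | ENNReal.ofReal γ < ENNReal.ofReal (c * a) / b} =
      expNeg (ENNReal.ofReal (γ / c) * b) := by
  have h1 : ∀ a, ENNReal.ofReal γ < ENNReal.ofReal (c * a) / b ↔
      ENNReal.ofReal γ * b < ENNReal.ofReal (c * a) := by
    intro a
    rcases eq_or_ne b ∞ with rfl | hb
    · simp [ENNReal.mul_top, hγ]
    -- The value `b = 0` is no exception: since `x / 0 = ∞` for `x > 0` and `0 / 0 = 0`, both sides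
    -- then say `0 < c * a`.
    · exact ENNReal.lt_div_iff_mul_lt (Or.inr ENNReal.ofReal_ne_top) (Or.inl hb)
  simp only [h1]
  rcases eq_or_ne b ∞ with rfl | hb
  · have h2 : ENNReal.ofReal (γ / c) ≠ 0 := by simpa using div_pos hγ hc
    have h3 : ENNReal.ofReal γ ≠ 0 := by simpa using hγ
    simp [ENNReal.mul_top h2, ENNReal.mul_top h3]
  · obtain ⟨r, hr, rfl⟩ : ∃ r : ℝ, 0 ≤ r ∧ b = ENNReal.ofReal r :=
      ⟨b.toReal, ENNReal.toReal_nonneg, (ENNReal.ofReal_toReal hb).symm⟩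
    rw [← ENNReal.ofReal_mul hγ.le, ← ENNReal.ofReal_mul (by positivity),
      expNeg_ofReal (by positivity), ← expMeasure_Ioi (by positivity)]
    congr 1; ext a
    simp only [Set.mem_ofPred_eq, Set.mem_Ioi]
    rw [ENNReal.ofReal_lt_ofReal_iff_of_nonneg (by positivity), div_mul_eq_mul_div,
      div_lt_iff₀ hc, mul_comm a c]

/-- Laplace transform of the exponential distribution. -/
lemma lintegral_expNeg_expMeasure {c : ℝ} (hc : 0 ≤ c) :
    ∫⁻ a, expNeg (ENNReal.ofReal (c * a)) ∂(expMeasure 1) = ENNReal.ofReal (1 / (1 + c)) := by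
  have h0 : expMeasure 1 = volume.withDensity (exponentialPDF 1) := rfl
  have hm : Measurable (exponentialPDF 1) := (measurable_exponentialPDFReal 1).ennreal_ofReal
  have hm' : Measurable fun a : ℝ => expNeg (ENNReal.ofReal (c * a)) :=
    measurable_expNeg.comp (by fun_prop)
  rw [h0, lintegral_withDensity_eq_lintegral_mul _ hm hm']
  -- The product with the density is again an exponential density, of rate `1 + c`, up to the factor
  -- `1 / (1 + c)`.
  have h1 : ∀ a, (exponentialPDF 1 * fun a => expNeg (ENNReal.ofReal (c * a))) a =
      ENNReal.ofReal (1 / (1 + c)) * exponentialPDF (1 + c) a := by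
    intro a
    simp only [Pi.mul_apply]
    rcases lt_or_ge a 0 with h | h
    · simp [exponentialPDF_of_neg h]
    · rw [exponentialPDF_of_nonneg h, exponentialPDF_of_nonneg h, expNeg_ofReal (by positivity),
        ← ENNReal.ofReal_mul (by positivity), ← ENNReal.ofReal_mul (by positivity), one_mul,
        ← Real.exp_add, ← mul_assoc, one_div_mul_cancel (by positivity), one_mul]
      congr 2
      ring_nf
  simp only [h1]
  have hm2 : Measurable (exponentialPDF (1 + c)) :=
    (measurable_exponentialPDFReal _).ennreal_ofReal
  rw [lintegral_const_mul _ hm2, lintegral_exponentialPDF_eq_one (by positivity), mul_one]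

/-! ### Coverage for given path losses -/

/-- Law of the pair that consists of the activity mark and of the fading gain of a link. -/
def fadingLaw : Measure (ℝ × ℝ) := unif.prod (expMeasure 1)

instance : IsProbabilityMeasure fadingLaw := by unfold fadingLaw; infer_instance

/-- An inactive interferer contributes 1, an active one the Laplace transform `1 / (1 + b c)`; the
average is `(1 - p) + p / (1 + b c)`. -/
lemma lintegral_fadingLaw {p b c : ℝ} (hp0 : 0 ≤ p) (hp1 : p ≤ 1) (hb : 0 ≤ b) (hc : 0 ≤ c) :
    ∫⁻ w, expNeg (ENNReal.ofReal b * if w.1 ≤ p then ENNReal.ofReal (c * w.2) else 0) ∂fadingLaw =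
      ENNReal.ofReal (1 - p * (b * c / (1 + b * c))) := by
  have hm : Measurable fun w : ℝ × ℝ =>
      expNeg (ENNReal.ofReal b * if w.1 ≤ p then ENNReal.ofReal (c * w.2) else 0) := by
    refine measurable_expNeg.comp (Measurable.const_mul (Measurable.ite ?_ ?_ ?_) _)
    · exact measurableSet_le measurable_fst measurable_const
    · fun_prop
    · fun_prop
  have hbc : 0 ≤ b * c := mul_nonneg hb hc
  have h1 : ∀ v : ℝ, ∫⁻ g, expNeg (ENNReal.ofReal b * if v ≤ p then ENNReal.ofReal (c * g) else 0)
      ∂(expMeasure 1) = (Set.Iic p).indicator (fun _ => ENNReal.ofReal (1 / (1 + b * c))) v +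
        (Set.Iic p)ᶜ.indicator (fun _ => 1) v := by
    intro v
    by_cases h : v ≤ p
    · simp only [h, if_true]
      simp only [← ENNReal.ofReal_mul hb, ← mul_assoc]
      rw [lintegral_expNeg_expMeasure hbc]
      simp [h]
    · simp [Set.indicator, h]
  rw [fadingLaw, lintegral_prod _ hm.aemeasurable]
  simp only [h1]
  rw [lintegral_add_left (measurable_const.indicator measurableSet_Iic),
    lintegral_indicator measurableSet_Iic, lintegral_indicator measurableSet_Iic.compl,
    setLIntegral_const, setLIntegral_const, prob_compl_eq_one_sub measurableSet_Iic,
    unif_Iic hp1, ← ENNReal.ofReal_mul (by positivity), one_mul, ← ENNReal.ofReal_one,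
    ← ENNReal.ofReal_sub _ hp0, ← ENNReal.ofReal_add (by positivity) (by linarith)]
  congr 1
  field_simp
  ring

/-- The expected effect, on the coverage, of an interferer of path loss `z` that is active with
probability `p`, when the serving base station has path loss `t`. -/
def interfererFactor (p γ t z : ℝ) : ℝ≥0∞ := ENNReal.ofReal (1 - p * (γ * z / (t + γ * z)))

lemma interfererFactor_le_one {p γ t z : ℝ} (hp : 0 ≤ p) (hγ : 0 ≤ γ) (ht : 0 ≤ t) (hz : 0 ≤ z) :
    interfererFactor p γ t z ≤ 1 := by
  rw [interfererFactor, ENNReal.ofReal_le_one]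
  have : 0 ≤ p * (γ * z / (t + γ * z)) := by positivity
  linarith

/-- A stronger server suffers less from a given interferer. This monotonicity lets constants replace
the random serving gain. -/
lemma interfererFactor_mono {p γ t t' z : ℝ} (hp : 0 ≤ p) (hγ : 0 ≤ γ) (ht : 0 < t) (hz : 0 ≤ z)
    (h : t ≤ t') : interfererFactor p γ t z ≤ interfererFactor p γ t' z := by
  refine ENNReal.ofReal_le_ofReal (sub_le_sub_left (mul_le_mul_of_nonneg_left ?_ hp) 1)
  exact div_le_div_of_nonneg_left (by positivity) (by positivity) (by linarith)

/-- Coverage by base station `k`, for given path losses `z`, in terms of the activity marks and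
fading gains. -/
def coverSet (P PN γ p : ℝ) (z : ℕ → ℝ) (k : ℕ) : Set (ℕ → ℝ × ℝ) :=
  {w | ENNReal.ofReal γ < ENNReal.ofReal (P * z k * (w k).2) /
    ((∑' i, if i ≠ k ∧ (w i).1 ≤ p then ENNReal.ofReal (P * z i * (w i).2) else 0) +
      ENNReal.ofReal PN)}

lemma measurableSet_coverSet_prod {α : Type*} [MeasurableSpace α] (P PN γ p : ℝ)
    {z : ℕ → α → ℝ} (hz : ∀ i, Measurable (z i)) (k : ℕ) :
    MeasurableSet {q : α × (ℕ → ℝ × ℝ) | q.2 ∈ coverSet P PN γ p (fun i => z i q.1) k} := by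
  simp only [coverSet, Set.mem_ofPred_eq]
  refine measurableSet_lt measurable_const (Measurable.div ?_ ?_)
  · have := hz k; fun_prop
  · refine Measurable.add_const (Measurable.tsum fun i => Measurable.ite ?_ ?_ ?_) _
    · exact MeasurableSet.inter (.const _) (measurableSet_le
        (f := fun q : α × (ℕ → ℝ × ℝ) => (q.2 i).1) (by fun_prop) measurable_const)
    · have := hz i; fun_prop
    · fun_prop

lemma measurableSet_coverSet (P PN γ p : ℝ) (z : ℕ → ℝ) (k : ℕ) :
    MeasurableSet (coverSet P PN γ p z k) :=
  (measurableSet_coverSet_prod (α := Unit) P PN γ p (z := fun i _ => z i)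
    (fun _ => measurable_const) k).preimage (f := fun w => ((), w)) (by fun_prop)

/-- Given everything else, the exponential tail of the serving fading is the exponential of minus
noise and interference. The latter factorizes over the interferers, whose marks are independent. -/
lemma measure_coverSet {P PN γ p : ℝ} {z : ℕ → ℝ} (hP : 0 < P) (hPN : 0 ≤ PN) (hγ : 0 < γ)
    (hp0 : 0 ≤ p) (hp1 : p ≤ 1) (hz : ∀ i, 0 < z i) (k : ℕ) :
    (Measure.infinitePi fun _ : ℕ => fadingLaw) (coverSet P PN γ p z k) =
      ENNReal.ofReal (Real.exp (-(PN * γ / (P * z k)))) *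
        infProd fun i => if i = k then 1 else interfererFactor p γ (z k) (z i) := by
  classical
  have hS := measurableSet_coverSet P PN γ p z k
  have hPz : 0 < P * z k := mul_pos hP (hz k)
  set b : ℝ := γ / (P * z k) with hb
  have hb0 : 0 < b := by positivity
  rw [← lintegral_indicator_one hS,
    lintegral_infinitePi_update _ k (measurable_one.indicator hS)]
  -- The term at `k` is set to zero, so the interference is unaffected by resampling the mark of
  -- `k`.
  let Y : ℕ → ℝ × ℝ → ℝ≥0∞ := fun i a =>
    if i = k then 0 else if a.1 ≤ p then ENNReal.ofReal (P * z i * a.2) else 0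
  have hY : ∀ i, Measurable (Y i) := by
    intro i
    refine Measurable.ite (.const _) measurable_const (Measurable.ite ?_ ?_ ?_)
    · exact measurableSet_le measurable_fst measurable_const
    · fun_prop
    · fun_prop
  have hI : ∀ (w : ℕ → ℝ × ℝ) (a : ℝ × ℝ), (∑' i, if i ≠ k ∧ (Function.update w k a i).1 ≤ p then
      ENNReal.ofReal (P * z i * (Function.update w k a i).2) else 0) = ∑' i, Y i (w i) := by
    intro w a
    refine tsum_congr fun i => ?_
    by_cases h : i = k
    · simp [Y, h]
    · simp [Y, h]
  have h1 : ∀ w : ℕ → ℝ × ℝ, ∫⁻ a, (coverSet P PN γ p z k).indicator 1 (Function.update w k a)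
      ∂fadingLaw = expNeg (ENNReal.ofReal b * ENNReal.ofReal PN) *
        infProd fun i => expNeg (ENNReal.ofReal b * Y i (w i)) := by
    intro w
    have h2 : (fun a => (coverSet P PN γ p z k).indicator (1 : (ℕ → ℝ × ℝ) → ℝ≥0∞)
        (Function.update w k a)) = (Prod.snd ⁻¹' {g : ℝ | ENNReal.ofReal γ <
          ENNReal.ofReal (P * z k * g) / ((∑' i, Y i (w i)) + ENNReal.ofReal PN)}).indicator 1 := by
      ext a
      refine Set.indicator_eq_indicator ?_ rfl
      change ENNReal.ofReal γ < _ ↔ ENNReal.ofReal γ < _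
      rw [hI, Function.update_self]
    have hm : MeasurableSet {g : ℝ | ENNReal.ofReal γ <
          ENNReal.ofReal (P * z k * g) / ((∑' i, Y i (w i)) + ENNReal.ofReal PN)} :=
      measurableSet_lt measurable_const (by fun_prop)
    rw [h2, lintegral_indicator_one (hm.preimage measurable_snd)]
    have h3 : fadingLaw.map Prod.snd = expMeasure 1 := by
      rw [fadingLaw, Measure.map_snd_prod, measure_univ, one_smul]
    rw [← Measure.map_apply measurable_snd hm, h3, expMeasure_lt_mul hγ hPz, add_comm, mul_add,
      expNeg_add, ← expNeg_tsum, ENNReal.tsum_mul_left]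
  simp only [h1]
  have hm : ∀ i, Measurable fun a => expNeg (ENNReal.ofReal b * Y i a) := fun i =>
    measurable_expNeg.comp ((hY i).const_mul _)
  have hm' : Measurable fun w : ℕ → ℝ × ℝ =>
      infProd fun i => expNeg (ENNReal.ofReal b * Y i (w i)) :=
    Measurable.infProd fun i => (hm i).comp (measurable_pi_apply i)
  rw [lintegral_const_mul _ hm',
    lintegral_infProd_infinitePi _ hm fun i a => expNeg_le_one _,
    ← ENNReal.ofReal_mul hb0.le, expNeg_ofReal (by positivity)]
  congr 3
  · rw [hb]; ring
  · ext i
    by_cases h : i = k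
    · simp [Y, h]
    · simp only [Y, h, if_false]
      rw [lintegral_fadingLaw hp0 hp1 hb0.le (mul_pos hP (hz i)).le, interfererFactor]
      have := hz k; have := hz i
      congr 3
      rw [hb]
      field_simp

/-- Lowering the serving gain to `t` and inserting a factor at `k`, which is at most 1, both
decrease the expression. The bound no longer involves `k`. -/
lemma le_measure_coverSet {P PN γ p t : ℝ} {z : ℕ → ℝ} (hP : 0 < P) (hPN : 0 ≤ PN) (hγ : 0 < γ)
    (hp0 : 0 ≤ p) (hp1 : p ≤ 1) (hz : ∀ i, 0 < z i) {k : ℕ} (ht : 0 < t) (htk : t ≤ z k) :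
    ENNReal.ofReal (Real.exp (-(PN * γ / (P * t)))) *
        infProd (fun i => interfererFactor p γ t (z i)) ≤
      (Measure.infinitePi fun _ : ℕ => fadingLaw) (coverSet P PN γ p z k) := by
  rw [measure_coverSet hP hPN hγ hp0 hp1 hz]
  refine mul_le_mul' (ENNReal.ofReal_le_ofReal (Real.exp_le_exp.2 (neg_le_neg ?_)))
    (infProd_mono fun i => ?_)
  · exact div_le_div_of_nonneg_left (by positivity) (by positivity) (by gcongr)
  · split_ifs
    · exact interfererFactor_le_one hp0 hγ.le ht.le (hz i).le
    · exact interfererFactor_mono hp0 hγ.le ht (hz i).le htk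

/-- The constant is the factor of an interferer exactly as strong as the server. It is at most the
factor missing at `k`, as `z k ≤ t`, so it completes the product to one over all indices. -/
lemma measure_coverSet_le {P PN γ p t : ℝ} {z : ℕ → ℝ} (hP : 0 < P) (hPN : 0 ≤ PN) (hγ : 0 < γ)
    (hp0 : 0 ≤ p) (hp1 : p ≤ 1) (hz : ∀ i, 0 < z i) {k : ℕ} (htk : z k ≤ t) :
    ENNReal.ofReal (1 - p * (γ / (1 + γ))) *
        (Measure.infinitePi fun _ : ℕ => fadingLaw) (coverSet P PN γ p z k) ≤
      ENNReal.ofReal (Real.exp (-(PN * γ / (P * t)))) *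
        infProd (fun i => interfererFactor p γ t (z i)) := by
  have hk := hz k
  have ht : 0 < t := hk.trans_le htk
  set C := ENNReal.ofReal (1 - p * (γ / (1 + γ))) with hC
  have hC1 : C ≤ 1 := by
    rw [hC, ENNReal.ofReal_le_one]
    have : 0 ≤ p * (γ / (1 + γ)) := by positivity
    linarith
  rw [measure_coverSet hP hPN hγ hp0 hp1 hz, mul_left_comm]
  refine mul_le_mul' (ENNReal.ofReal_le_ofReal (Real.exp_le_exp.2 (neg_le_neg ?_)))
    (le_iInf fun n => ?_)
  · exact div_le_div_of_nonneg_left (by positivity) (by positivity) (by gcongr)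
  refine (mul_le_mul_right (iInf_le _ n) C).trans ?_
  -- If `k` lies outside the range, the product is 1 and `C ≤ 1` suffices.
  have h1 : C ≤ ∏ i ∈ Finset.range n, if i = k then C else 1 := by
    rw [Finset.prod_ite_eq']
    split_ifs
    · exact le_rfl
    · exact hC1
  refine (mul_le_mul_left h1 _).trans ?_
  rw [← Finset.prod_mul_distrib]
  refine Finset.prod_le_prod' fun i _ => ?_
  split_ifs with h
  · subst h
    rw [mul_one, hC, interfererFactor]
    refine ENNReal.ofReal_le_ofReal (sub_le_sub_left (mul_le_mul_of_nonneg_left ?_ hp0) 1)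
    rw [div_le_div_iff₀ (by positivity) (by positivity)]
    nlinarith
  · rw [one_mul]
    exact interfererFactor_mono hp0 hγ.le hk (hz i).le htk

/-- Nontriviality of this filter is what makes the real-valued essential supremum `maxGain` bounded
below and positive. -/
instance : (ae ((volume : Measure Plane).prod unif)).NeBot := by
  refine ae_neBot.2 fun h => ?_
  have h1 : ((volume : Measure Plane).prod unif) (Set.univ ×ˢ Set.univ) = 0 := by simp [h]
  rw [Measure.prod_prod, measure_univ (μ := unif), mul_one] at h1
  exact (isOpen_univ.measure_pos volume (Set.univ_nonempty : (Set.univ : Set Plane).Nonempty)).ne'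
    h1

/-! ### Measurability and size of the path loss -/

lemma le_dist3D (L r : ℝ) : L ≤ dist3D L r :=
  Real.le_sqrt_of_sq_le (by nlinarith [sq_nonneg r])

lemma continuous_dist3D (L : ℝ) : Continuous (dist3D L) := by
  unfold dist3D; fun_prop

lemma le_dist3D_self (L r : ℝ) : r ≤ dist3D L r :=
  Real.le_sqrt_of_sq_le (by nlinarith [sq_nonneg L])

lemma pieceIndex_mono {m : ℕ} (d : Fin m → ℝ) : Monotone (pieceIndex d) := by
  intro v w h
  refine Fin.mk_le_mk.2 (Finset.card_le_card fun k hk => ?_)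
  simp only [Finset.mem_filter, Finset.mem_univ, true_and] at hk ⊢
  exact hk.trans_le h

lemma measurable_pieceIndex {m : ℕ} (d : Fin m → ℝ) : Measurable (pieceIndex d) := by
  have h : Measurable fun w => (pieceIndex d w : ℕ) :=
    Monotone.measurable fun v w h => pieceIndex_mono d h
  refine measurable_to_countable' fun n => ?_
  have h2 := h (measurableSet_singleton (n : ℕ))
  convert h2 using 1
  ext w
  simp [Fin.ext_iff]

lemma pieceIndex_eventually_last {m : ℕ} (d : Fin m → ℝ) :
    ∀ᶠ w in atTop, pieceIndex d w = Fin.last m := by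
  have h : ∀ᶠ w in atTop, ∀ k, d k < w := eventually_all.2 fun k => eventually_gt_atTop (d k)
  filter_upwards [h] with w hw
  refine Fin.ext ?_
  simp [pieceIndex, Finset.filter_true_of_mem fun k _ => hw k]

namespace PathLoss

variable {m : ℕ} {L : ℝ} (M : PathLoss m L)

lemma measurable_gainLoS : Measurable M.gainLoS := by
  unfold gainLoS pieceLoS
  have h1 : Measurable fun w => M.AL (pieceIndex M.d w) :=
    (measurable_of_finite M.AL).comp (measurable_pieceIndex M.d)
  have h2 : Measurable fun w => M.αL (pieceIndex M.d w) :=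
    (measurable_of_finite M.αL).comp (measurable_pieceIndex M.d)
  exact h1.mul (measurable_id.pow h2.neg)

lemma measurable_gainNLoS : Measurable M.gainNLoS := by
  unfold gainNLoS pieceNLoS
  have h1 : Measurable fun w => M.ANL (pieceIndex M.d w) :=
    (measurable_of_finite M.ANL).comp (measurable_pieceIndex M.d)
  have h2 : Measurable fun w => M.αNL (pieceIndex M.d w) :=
    (measurable_of_finite M.αNL).comp (measurable_pieceIndex M.d)
  exact h1.mul (measurable_id.pow h2.neg)

/-- Measurability comes from monotonicity: on each piece the superlevel sets of `prL` are
order-convex. Composing with `dist3D` keeps the argument at least `L`, where the model constrains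
`prL`. -/
lemma measurable_probLoS_dist3D : Measurable fun r => M.probLoS (dist3D L r) := by
  refine measurable_of_Ici fun c => ?_
  have h : (fun r => M.probLoS (dist3D L r)) ⁻¹' Set.Ici c = dist3D L ⁻¹' ⋃ n,
      {w | (L ≤ w ∧ pieceIndex M.d w = n) ∧ c ≤ M.prL n w} := by
    ext r
    simp only [Set.mem_preimage, Set.mem_Ici, Set.mem_iUnion, Set.mem_ofPred_eq, probLoS]
    constructor
    · intro h; exact ⟨_, ⟨le_dist3D L r, rfl⟩, h⟩
    · rintro ⟨n, ⟨_, rfl⟩, h⟩; exact h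
  rw [h]
  refine (MeasurableSet.iUnion fun n => Set.OrdConnected.measurableSet ⟨?_⟩).preimage
    (continuous_dist3D L).measurable
  rintro a ⟨⟨ha, ha'⟩, hac⟩ b ⟨⟨hb, hb'⟩, hbc⟩ x ⟨hax, hxb⟩
  have hx : L ≤ x ∧ pieceIndex M.d x = n := ⟨ha.trans hax, le_antisymm
    ((pieceIndex_mono M.d hxb).trans_eq hb') (ha'.symm.trans_le (pieceIndex_mono M.d hax))⟩
  exact ⟨hx, hbc.trans (M.prL_antitone n hx ⟨hb, hb'⟩ hxb)⟩

lemma probLoS_mem (r : ℝ) : M.probLoS (dist3D L r) ∈ Set.Icc (0 : ℝ) 1 :=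
  M.prL_mem _ _ (le_dist3D L r) rfl

lemma gainLoS_pos {w : ℝ} (hw : 0 < w) : 0 < M.gainLoS w :=
  mul_pos (M.AL_pos _) (Real.rpow_pos_of_pos hw _)

lemma gainNLoS_pos {w : ℝ} (hw : 0 < w) : 0 < M.gainNLoS w :=
  mul_pos (M.ANL_pos _) (Real.rpow_pos_of_pos hw _)

lemma tendsto_gainLoS : Tendsto M.gainLoS atTop (𝓝 0) := by
  have h : Tendsto (fun w => M.pieceLoS (Fin.last m) w) atTop (𝓝 0) := by
    simpa [pieceLoS] using (tendsto_rpow_neg_atTop (M.αL_pos (Fin.last m))).const_mul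
      (M.AL (Fin.last m))
  refine h.congr' ?_
  filter_upwards [pieceIndex_eventually_last M.d] with w hw
  rw [gainLoS, hw]

lemma tendsto_gainNLoS : Tendsto M.gainNLoS atTop (𝓝 0) := by
  have h : Tendsto (fun w => M.pieceNLoS (Fin.last m) w) atTop (𝓝 0) := by
    simpa [pieceNLoS] using (tendsto_rpow_neg_atTop (M.αNL_pos (Fin.last m))).const_mul
      (M.ANL (Fin.last m))
  refine h.congr' ?_
  filter_upwards [pieceIndex_eventually_last M.d] with w hw
  rw [gainNLoS, hw]

open Classical in
/-- Path loss of the link to a base station at position `a.1` with line-of-sight mark `a.2`. -/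
def linkGain (a : Plane × ℝ) : ℝ :=
  if a.2 ≤ M.probLoS (dist3D L ‖a.1‖) then M.gainLoS (dist3D L ‖a.1‖)
  else M.gainNLoS (dist3D L ‖a.1‖)

lemma measurable_linkGain : Measurable M.linkGain := by
  have hd : Measurable fun a : Plane × ℝ => dist3D L ‖a.1‖ :=
    (continuous_dist3D L).measurable.comp (by fun_prop)
  refine Measurable.ite (measurableSet_le measurable_snd ?_) (M.measurable_gainLoS.comp hd)
    (M.measurable_gainNLoS.comp hd)
  exact (M.measurable_probLoS_dist3D).comp (g := fun r => M.probLoS (dist3D L r))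
    (by fun_prop : Measurable fun a : Plane × ℝ => ‖a.1‖)

lemma linkGain_pos (hL : 0 < L) (a : Plane × ℝ) : 0 < M.linkGain a := by
  have h := hL.trans_le (le_dist3D L ‖a.1‖)
  unfold linkGain
  split_ifs
  · exact M.gainLoS_pos h
  · exact M.gainNLoS_pos h

lemma exists_linkGain_le (hL : 0 < L) : ∃ G, ∀ a, M.linkGain a ≤ G := by
  refine ⟨∑ n, (M.AL n * L ^ (-M.αL n) + M.ANL n * L ^ (-M.αNL n)), fun a => ?_⟩
  have hw := le_dist3D L ‖a.1‖
  have h1 : ∀ n, 0 < M.AL n * L ^ (-M.αL n) := fun n =>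
    mul_pos (M.AL_pos n) (Real.rpow_pos_of_pos hL _)
  have h2 : ∀ n, 0 < M.ANL n * L ^ (-M.αNL n) := fun n =>
    mul_pos (M.ANL_pos n) (Real.rpow_pos_of_pos hL _)
  have h3 : ∀ n, M.AL n * L ^ (-M.αL n) + M.ANL n * L ^ (-M.αNL n) ≤
      ∑ n, (M.AL n * L ^ (-M.αL n) + M.ANL n * L ^ (-M.αNL n)) := fun n =>
    Finset.single_le_sum (f := fun n => M.AL n * L ^ (-M.αL n) + M.ANL n * L ^ (-M.αNL n))
      (fun n _ => (add_pos (h1 n) (h2 n)).le) (Finset.mem_univ n)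
  have h4 : ∀ n, M.pieceLoS n (dist3D L ‖a.1‖) ≤ M.AL n * L ^ (-M.αL n) := fun n =>
    mul_le_mul_of_nonneg_left (Real.rpow_le_rpow_of_nonpos hL hw
      (neg_nonpos.2 (M.αL_pos n).le)) (M.AL_pos n).le
  have h5 : ∀ n, M.pieceNLoS n (dist3D L ‖a.1‖) ≤ M.ANL n * L ^ (-M.αNL n) := fun n =>
    mul_le_mul_of_nonneg_left (Real.rpow_le_rpow_of_nonpos hL hw
      (neg_nonpos.2 (M.αNL_pos n).le)) (M.ANL_pos n).le
  set n := pieceIndex M.d (dist3D L ‖a.1‖) with hn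
  unfold linkGain gainLoS gainNLoS
  rw [← hn]
  have := h1 n; have := h2 n; have := h3 n; have := h4 n; have := h5 n
  split_ifs <;> linarith

/-- Links of gain at least `ε` stay in a bounded disc, uniformly in the mark, so only finitely many
stations have them. An integer radius leaves countably many null sets to discard. -/
lemma exists_linkGain_lt {ε : ℝ} (hε : 0 < ε) :
    ∃ R : ℕ, ∀ a : Plane × ℝ, (R : ℝ) ≤ ‖a.1‖ → M.linkGain a < ε := by
  have h1 := (M.tendsto_gainLoS.eventually (gt_mem_nhds hε)).and
    (M.tendsto_gainNLoS.eventually (gt_mem_nhds hε))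
  obtain ⟨R, hR⟩ := eventually_atTop.1 h1
  obtain ⟨N, hN⟩ := exists_nat_ge R
  refine ⟨N, fun a ha => ?_⟩
  have h := hR _ ((hN.trans ha).trans (le_dist3D_self L ‖a.1‖))
  unfold linkGain
  split_ifs
  · exact h.1
  · exact h.2

/-! ### The strongest possible link and the interference integral. -/

/-- The supremum of the path losses that occur with positive probability. -/
def maxGain : ℝ := essSup M.linkGain ((volume : Measure Plane).prod unif)

lemma isBoundedUnder_linkGain (hL : 0 < L) :
    IsBoundedUnder (· ≤ ·) (ae ((volume : Measure Plane).prod unif)) M.linkGain := by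
  obtain ⟨G, hG⟩ := M.exists_linkGain_le hL
  exact ⟨G, eventually_map.2 (ae_of_all _ hG)⟩

lemma isCoboundedUnder_linkGain (hL : 0 < L) :
    IsCoboundedUnder (· ≤ ·) (ae ((volume : Measure Plane).prod unif)) M.linkGain :=
  IsBoundedUnder.isCoboundedUnder_le
    ⟨0, eventually_map.2 (ae_of_all _ fun a => (M.linkGain_pos hL a).le)⟩

lemma linkGain_le_maxGain (hL : 0 < L) :
    ∀ᵐ a ∂((volume : Measure Plane).prod unif), M.linkGain a ≤ M.maxGain :=
  ae_le_essSup (M.isBoundedUnder_linkGain hL)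

lemma maxGain_le (hL : 0 < L) {t : ℝ}
    (h : ∀ᵐ a ∂((volume : Measure Plane).prod unif), M.linkGain a ≤ t) : M.maxGain ≤ t :=
  limsup_le_of_le (M.isCoboundedUnder_linkGain hL) h

lemma maxGain_pos (hL : 0 < L) : 0 < M.maxGain := by
  obtain ⟨a, ha⟩ := (M.linkGain_le_maxGain hL).exists
  exact (M.linkGain_pos hL a).trans_le ha

lemma measure_le_linkGain_ne_zero (hL : 0 < L) {t : ℝ} (ht : t < M.maxGain) :
    ((volume : Measure Plane).prod unif) {a | t ≤ M.linkGain a} ≠ 0 := by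
  intro h
  refine ht.not_ge (M.maxGain_le hL ?_)
  rw [measure_eq_zero_iff_ae_notMem] at h
  filter_upwards [h] with a ha
  exact (not_le.1 ha).le

/-- If LoS links of nearly minimal length are possible and no link is stronger than an LoS link of
minimal length, then the latter is the strongest link. -/
lemma maxGain_eq (hL : 0 < L) (h1 : ∃ w, L < w ∧ pieceIndex M.d w = 0 ∧ 0 < M.prL 0 w)
    (h2 : ∀ w, L ≤ w → M.gainLoS w ≤ M.pieceLoS 0 L ∧ M.gainNLoS w ≤ M.pieceLoS 0 L) :
    M.maxGain = M.pieceLoS 0 L := by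
  refine le_antisymm (M.maxGain_le hL (ae_of_all _ fun a => ?_)) (le_of_forall_lt fun t ht => ?_)
  · have h := h2 _ (le_dist3D L ‖a.1‖)
    unfold linkGain
    split_ifs
    · exact h.1
    · exact h.2
  · obtain ⟨w, hw, hw0, hp⟩ := h1
    by_contra hcon
    push Not at hcon
    have hcont : ContinuousAt (M.pieceLoS 0) L :=
      continuousAt_const.mul (Real.continuousAt_rpow_const _ _ (Or.inl hL.ne'))
    have hev : ∀ᶠ v in 𝓝 L, t < M.pieceLoS 0 v := hcont.eventually (lt_mem_nhds ht)
    obtain ⟨δ, hδ, hδ'⟩ := Metric.eventually_nhds_iff.1 hev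
    have hd0 : ContinuousAt (fun x : Plane => dist3D L ‖x‖) 0 :=
      ((continuous_dist3D L).comp continuous_norm).continuousAt
    have hL0 : dist3D L ‖(0 : Plane)‖ = L := by simp [dist3D, Real.sqrt_sq hL.le]
    have hev2 : ∀ᶠ x : Plane in 𝓝 0, dist3D L ‖x‖ < min w (L + δ) := by
      refine hd0.eventually (gt_mem_nhds ?_)
      simp only [hL0]
      exact lt_min hw (by linarith)
    obtain ⟨r, hr, hr'⟩ := Metric.eventually_nhds_iff.1 hev2
    -- Nearby stations with mark at most `prL 0 w` are LoS, because shorter links in the piece have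
    -- larger LoS probability. They would exceed `maxGain` on a set of positive measure.
    have hsub : Metric.ball (0 : Plane) r ×ˢ Set.Iic (M.prL 0 w) ⊆
        {a | M.maxGain < M.linkGain a} := by
      rintro ⟨x, u⟩ ⟨hx, hu⟩
      have hx' := hr' hx
      have hLx := le_dist3D L ‖x‖
      have hi : pieceIndex M.d (dist3D L ‖x‖) = 0 :=
        le_antisymm ((pieceIndex_mono M.d (hx'.le.trans (min_le_left _ _))).trans_eq hw0)
          (Fin.zero_le _)
      have hpr : M.prL 0 w ≤ M.prL 0 (dist3D L ‖x‖) :=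
        M.prL_antitone 0 ⟨hLx, hi⟩ ⟨hw.le, hw0⟩ (hx'.le.trans (min_le_left _ _))
      have hu' : u ≤ M.probLoS (dist3D L ‖x‖) := by
        rw [probLoS, hi]; exact le_trans hu hpr
      change M.maxGain < if u ≤ M.probLoS (dist3D L ‖x‖) then M.gainLoS (dist3D L ‖x‖)
        else M.gainNLoS (dist3D L ‖x‖)
      rw [if_pos hu', gainLoS, hi]
      refine hcon.trans_lt (hδ' ?_)
      rw [Real.dist_eq, abs_of_nonneg (by linarith)]
      have := hx'.trans_le (min_le_right _ _)
      linarith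
    have hzero : ((volume : Measure Plane).prod unif) {a | M.maxGain < M.linkGain a} = 0 := by
      have := M.linkGain_le_maxGain hL
      rw [ae_iff] at this
      simpa using this
    have := measure_mono_null hsub hzero
    rw [Measure.prod_prod, mul_eq_zero] at this
    rcases this with h | h
    · exact (Metric.measure_ball_pos volume (0 : Plane) hr).ne' h
    · rw [unif_Iic (M.prL_mem 0 w hw.le hw0).2, ENNReal.ofReal_eq_zero] at h
      exact hp.not_ge h

/-- The integral that governs the interference for a serving base station of path loss `t`. -/
def interferenceIntegral (γ t : ℝ) : ℝ≥0∞ :=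
  ∫⁻ a, ENNReal.ofReal (γ * M.linkGain a / (t + γ * M.linkGain a))
    ∂((volume : Measure Plane).prod unif)

/-- Controls the integral as `t` increases to `t'`, even when it is infinite and dominated
convergence is unavailable. -/
lemma interferenceIntegral_le (hL : 0 < L) {γ t t' : ℝ} (hγ : 0 < γ) (ht : 0 < t) (h : t ≤ t') :
    M.interferenceIntegral γ t ≤ ENNReal.ofReal (t' / t) * M.interferenceIntegral γ t' := by
  have ht' := ht.trans_le h
  unfold interferenceIntegral
  rw [← lintegral_const_mul' _ _ ENNReal.ofReal_ne_top]
  refine lintegral_mono fun a => ?_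
  have hz := M.linkGain_pos hL a
  rw [← ENNReal.ofReal_mul (by positivity)]
  refine ENNReal.ofReal_le_ofReal ?_
  rw [div_mul_div_comm, div_le_div_iff₀ (by positivity) (by positivity)]
  have : 0 ≤ γ * M.linkGain a := by positivity
  nlinarith [mul_nonneg this (mul_nonneg (sub_nonneg.2 h) this)]

end PathLoss

/-! ### The interference integral in polar coordinates. -/

/-- Integration of a radial function in polar coordinates. -/
lemma lintegral_norm_plane {f : ℝ → ℝ≥0∞} (hf : Measurable f) :
    ∫⁻ x : Plane, f ‖x‖ = ENNReal.ofReal (2 * Real.pi) *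
      ∫⁻ r in Set.Ioi (0 : ℝ), ENNReal.ofReal r * f r := by
  have h1 : ∫⁻ z : ℂ, f ‖z‖ = ∫⁻ x : Plane, f ‖x‖ := by
    have := (Complex.orthonormalBasisOneI.repr.measurePreserving).lintegral_comp
      (f := fun x : Plane => f ‖x‖) (by fun_prop)
    simpa using this
  rw [← h1, ← Complex.lintegral_comp_polarCoord_symm]
  simp only [Complex.norm_polarCoord_symm]
  rw [polarCoord_target, Measure.volume_eq_prod, setLIntegral_prod _ (by fun_prop)]
  simp only [smul_eq_mul]
  rw [← lintegral_const_mul _ (by fun_prop)]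
  refine setLIntegral_congr_fun measurableSet_Ioi fun r hr => ?_
  rw [setLIntegral_const, Real.volume_Ioo, abs_of_pos hr, mul_comm]
  congr 2; ring

namespace PathLoss

variable {m : ℕ} {L : ℝ} (M : PathLoss m L)

/-- Averaging over the mark splits the integrand into LoS and NLoS parts with weights `pr` and `1 -
pr`; both are radial. -/
lemma interferenceIntegral_eq (hL : 0 < L) {P γ t : ℝ} (hP : 0 < P) (hγ : 0 < γ) (ht : 0 < t) :
    M.interferenceIntegral γ t = ENNReal.ofReal (2 * Real.pi) *
      (M.integralLoS P (γ / (P * t)) + M.integralNLoS P (γ / (P * t))) := by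
  let h : ℝ → ℝ≥0∞ := fun z => ENNReal.ofReal (γ * z / (t + γ * z))
  have hh : Measurable h := by fun_prop
  let pr : ℝ → ℝ := fun r => M.probLoS (dist3D L r)
  have hpr : Measurable pr := M.measurable_probLoS_dist3D
  have hg1 : Measurable fun r => M.gainLoS (dist3D L r) :=
    M.measurable_gainLoS.comp (continuous_dist3D L).measurable
  have hg2 : Measurable fun r => M.gainNLoS (dist3D L r) :=
    M.measurable_gainNLoS.comp (continuous_dist3D L).measurable
  have hfm : Measurable fun r => ENNReal.ofReal (pr r) * h (M.gainLoS (dist3D L r)) +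
      ENNReal.ofReal (1 - pr r) * h (M.gainNLoS (dist3D L r)) := by fun_prop
  have h1 : ∀ x : Plane, ∫⁻ u, h (M.linkGain (x, u)) ∂unif =
      ENNReal.ofReal (pr ‖x‖) * h (M.gainLoS (dist3D L ‖x‖)) +
        ENNReal.ofReal (1 - pr ‖x‖) * h (M.gainNLoS (dist3D L ‖x‖)) := by
    intro x
    have hmem : pr ‖x‖ ∈ Set.Icc (0 : ℝ) 1 := M.probLoS_mem ‖x‖
    have h2 : ∀ u, h (M.linkGain (x, u)) =
        (Set.Iic (pr ‖x‖)).indicator (fun _ => h (M.gainLoS (dist3D L ‖x‖))) u +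
          (Set.Iic (pr ‖x‖))ᶜ.indicator (fun _ => h (M.gainNLoS (dist3D L ‖x‖))) u := by
      intro u
      by_cases hu : u ≤ pr ‖x‖
      · simp [linkGain, hu, show u ≤ M.probLoS (dist3D L ‖x‖) from hu]
      · simp [linkGain, Set.indicator, hu, show ¬ u ≤ M.probLoS (dist3D L ‖x‖) from hu]
    simp only [h2]
    rw [lintegral_add_left (measurable_const.indicator measurableSet_Iic),
      lintegral_indicator measurableSet_Iic, lintegral_indicator measurableSet_Iic.compl,
      setLIntegral_const, setLIntegral_const, prob_compl_eq_one_sub measurableSet_Iic,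
      unif_Iic hmem.2, ← ENNReal.ofReal_one, ← ENNReal.ofReal_sub _ hmem.1, mul_comm,
      mul_comm (ENNReal.ofReal (1 - _))]
  have h3 : ∀ z, 0 < z → γ * z / (t + γ * z) = 1 / (1 + (γ / (P * t) * P * z)⁻¹) := by
    intro z hz
    have : (γ / (P * t) * P * z) = γ * z / t := by field_simp
    rw [this, inv_div]
    field_simp
    ring
  have h4 : M.interferenceIntegral γ t = ∫⁻ x : Plane, ∫⁻ u, h (M.linkGain (x, u)) ∂unif :=
    lintegral_prod (fun a => h (M.linkGain a)) (hh.comp (M.measurable_linkGain)).aemeasurable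
  rw [h4]
  simp only [h1]
  have hm : Measurable fun u => ENNReal.ofReal (M.probLoS (dist3D L u) * u /
      (1 + (γ / (P * t) * P * M.gainLoS (dist3D L u))⁻¹)) := by
    have := M.measurable_probLoS_dist3D
    fun_prop
  rw [lintegral_norm_plane hfm, integralLoS, integralNLoS, ← lintegral_add_left hm]
  congr 1
  refine setLIntegral_congr_fun measurableSet_Ioi fun r hr => ?_
  have hr' : (0 : ℝ) < r := hr
  have hw := hL.trans_le (le_dist3D L r)
  have hmem : pr r ∈ Set.Icc (0 : ℝ) 1 := M.probLoS_mem r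
  have hz1 := M.gainLoS_pos hw
  have hz2 := M.gainNLoS_pos hw
  have h0 : 0 ≤ 1 - pr r := sub_nonneg.2 hmem.2
  simp only [h]
  rw [mul_add, ← ENNReal.ofReal_mul hmem.1, ← ENNReal.ofReal_mul h0, ← ENNReal.ofReal_mul hr'.le,
    ← ENNReal.ofReal_mul hr'.le, h3 _ hz1, h3 _ hz2]
  congr 2
  · simp only [pr]; ring
  · simp only [pr]; ring

lemma coverageLimit_eq (hL : 0 < L) {P PN ρ γ : ℝ} (hP : 0 < P) (hρ : 0 < ρ) (hγ : 0 < γ)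
    (h : M.maxGain = M.pieceLoS 0 L) :
    M.coverageLimit P PN ρ γ = ENNReal.ofReal (Real.exp (-(PN * γ / (P * M.maxGain)))) *
      expNeg (ENNReal.ofReal ρ * M.interferenceIntegral γ M.maxGain) := by
  rw [coverageLimit, laplaceLimit, ← h, M.interferenceIntegral_eq hL hP hγ (M.maxGain_pos hL),
    ← mul_assoc (ENNReal.ofReal ρ), ← ENNReal.ofReal_mul hρ.le, mul_add, expNeg_add, mul_comm ρ]
  rfl

end PathLoss

/-! ### The serving base station -/

/-- The first index at which the sequence `z` is maximal. -/
def firstMaxIndex (z : ℕ → ℝ) : ℕ := sInf {i | ∀ j, z j ≤ z i}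

lemma measurable_firstMaxIndex : Measurable firstMaxIndex := by
  have hA : ∀ i, MeasurableSet {z : ℕ → ℝ | ∀ j, z j ≤ z i} := fun i => by
    rw [Set.ofPred_forall]
    exact MeasurableSet.iInter fun j =>
      measurableSet_le (measurable_pi_apply j) (measurable_pi_apply i)
  refine measurable_to_countable' fun k => ?_
  -- The second set accounts for `sInf ∅ = 0`: a sequence without maximum has index `0`.
  have h : firstMaxIndex ⁻¹' {k} =
      ({z : ℕ → ℝ | ∀ j, z j ≤ z k} ∩ ⋂ i ∈ Finset.range k, {z : ℕ → ℝ | ∀ j, z j ≤ z i}ᶜ) ∪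
        ((if k = 0 then Set.univ else ∅) ∩ ⋂ i, {z : ℕ → ℝ | ∀ j, z j ≤ z i}ᶜ) := by
    ext z
    simp only [Set.mem_preimage, Set.mem_singleton_iff, Set.mem_union, Set.mem_inter_iff,
      Set.mem_iInter, Finset.mem_range, firstMaxIndex]
    set A := {i | ∀ j, z j ≤ z i} with hA
    change sInf A = k ↔ (k ∈ A ∧ ∀ i, i < k → i ∉ A) ∨ (_ ∧ ∀ i, i ∉ A)
    constructor
    · rintro rfl
      rcases A.eq_empty_or_nonempty with h | h
      · right; simp [h]
      · left; exact ⟨Nat.sInf_mem h, fun i hi => Nat.notMem_of_lt_sInf hi⟩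
    · rintro (⟨h1, h2⟩ | ⟨h1, h2⟩)
      · refine le_antisymm (Nat.sInf_le h1) (not_lt.1 fun hlt => h2 _ hlt (Nat.sInf_mem ⟨k, h1⟩))
      · have : k = 0 := by by_contra hk; simp [hk] at h1
        rw [this, Set.eq_empty_of_forall_notMem h2, Nat.sInf_empty]
  rw [h]
  refine ((hA k).inter (Finset.measurableSet_biInter _ fun i _ => (hA i).compl)).union
    (MeasurableSet.inter ?_ (MeasurableSet.iInter fun i => (hA i).compl))
  split_ifs
  · exact .univ
  · exact .empty

/-- Only finitely many terms reach `z 0`, so a maximum exists among them. -/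
lemma le_firstMaxIndex {z : ℕ → ℝ} (hz : ∀ i, 0 < z i) (h : ∀ ε > 0, {i | ε ≤ z i}.Finite)
    (j : ℕ) : z j ≤ z (firstMaxIndex z) := by
  have hne : {i | ∀ j, z j ≤ z i}.Nonempty := by
    obtain ⟨k, hk, hk'⟩ := Set.exists_max_image _ z (h (z 0) (hz 0)) ⟨0, le_refl (z 0)⟩
    refine ⟨k, fun j => ?_⟩
    rcases le_or_gt (z 0) (z j) with hj | hj
    · exact hk' j hj
    · exact hj.le.trans hk
  exact Nat.sInf_mem hne j

lemma infProd_eq_zero {f : ℕ → ℝ≥0∞} {i : ℕ} (h : f i = 0) : infProd f = 0 := by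
  refine le_antisymm ((iInf_le _ (i + 1)).trans_eq ?_) zero_le
  exact Finset.prod_eq_zero (Finset.mem_range.2 (Nat.lt_succ_self i)) h

lemma lintegral_const_mul_add_one_sub {α β : Type*} [MeasurableSpace α] [MeasurableSpace β]
    (μ : Measure α) (κ : Measure β) [IsProbabilityMeasure μ] [IsProbabilityMeasure κ]
    {F G : α × β → ℝ≥0∞} (hF : Measurable F) (hG : Measurable G) (hG1 : ∀ x, G x ≤ 1) {e : ℝ≥0∞}
    (he : e ≠ ∞) :
    ∫⁻ a, ∫⁻ b, (e * F (a, b) + (1 - G (a, b))) ∂κ ∂μ =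
      e * ∫⁻ a, ∫⁻ b, F (a, b) ∂κ ∂μ + (1 - ∫⁻ a, ∫⁻ b, G (a, b) ∂κ ∂μ) := by
  rw [← lintegral_prod _ hF.aemeasurable, ← lintegral_prod _ hG.aemeasurable,
    ← lintegral_prod (fun x => e * F x + (1 - G x))
      ((hF.const_mul e).add (measurable_const.sub hG)).aemeasurable,
    lintegral_add_left (hF.const_mul e), lintegral_const_mul' _ _ he,
    lintegral_sub hG (ne_top_of_le_ne_top ENNReal.one_ne_top
      ((lintegral_mono hG1).trans (by simp))) (ae_of_all _ hG1)]
  simp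

/-! ### Averaging over positions and marks, and the two coverage bounds. -/

namespace Deployment.IsNetwork

variable {Ω : Type*} [MeasurableSpace Ω] {D : Deployment Ω} {lam : ℝ} {μ : Measure Ω}

lemma ae_finite (hD : D.IsNetwork lam μ) (R : ℝ) : ∀ᵐ ω ∂μ, {i | ‖D.X i ω‖ ≤ R}.Finite := by
  have h := hD.poisson.ae_pointCount_lt_top (B := Metric.closedBall (0 : Plane) R)
    Metric.isClosed_closedBall.measurableSet (by
      rw [Measure.smul_apply, smul_eq_mul]
      exact ENNReal.mul_ne_top ENNReal.ofReal_ne_top measure_closedBall_lt_top.ne)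
  filter_upwards [h] with ω hω
  simpa [pointCount] using Set.encard_lt_top_iff.1 hω

/-- The exceptional null set concerns positions alone, so the marks `u` may be quantified inside. -/
lemma ae_le_firstMaxIndex {m : ℕ} {L : ℝ} (M : PathLoss m L) (hD : D.IsNetwork lam μ) (hL : 0 < L) :
    ∀ᵐ ω ∂μ, ∀ (u : ℕ → ℝ) (j : ℕ), M.linkGain (D.X j ω, u j) ≤
      M.linkGain (D.X (firstMaxIndex fun i => M.linkGain (D.X i ω, u i)) ω,
        u (firstMaxIndex fun i => M.linkGain (D.X i ω, u i))) := by
  filter_upwards [ae_all_iff.2 fun n : ℕ => hD.ae_finite (n : ℝ)] with ω hω u j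
  refine le_firstMaxIndex (z := fun i => M.linkGain (D.X i ω, u i))
    (fun i => M.linkGain_pos hL _) (fun ε hε => ?_) j
  obtain ⟨R, hR⟩ := M.exists_linkGain_lt hε
  refine (hω R).subset fun i hi => ?_
  by_contra hcon
  exact (hR (D.X i ω, u i) (not_le.1 hcon).le).not_ge hi

lemma measurable_infProd_mark (hD : D.IsNetwork lam μ) {h : Plane × ℝ → ℝ≥0∞} (hm : Measurable h) :
    Measurable fun q : Ω × (ℕ → ℝ) => infProd fun i => h (D.X i q.1, q.2 i) :=
  Measurable.infProd fun i => hm.comp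
    (((hD.poisson.measurable i).comp measurable_fst).prodMk (by fun_prop))

variable [IsProbabilityMeasure μ]

/-- Joint law of the positions, the line-of-sight marks, and the other marks. -/
lemma measure_eq_lintegral (hD : D.IsNetwork lam μ)
    {S : Set ((ℕ → Plane) × ((ℕ → ℝ) × (ℕ → ℝ × ℝ)))} (hS : MeasurableSet S) :
    μ {ω | (fun i => D.X i ω, (fun i => D.U i ω, fun i => (D.V i ω, D.g i ω))) ∈ S} =
      ∫⁻ ω, ∫⁻ u, (Measure.infinitePi fun _ : ℕ => fadingLaw)
        {w | (fun i => D.X i ω, (u, w)) ∈ S} ∂(Measure.infinitePi fun _ : ℕ => unif) ∂μ := by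
  have hX : Measurable fun ω i => D.X i ω := measurable_pi_iff.2 hD.poisson.measurable
  have hm : ∀ i, Measurable fun ω => (D.U i ω, D.V i ω, D.g i ω) := fun i =>
    (hD.measurable_U i).prodMk ((hD.measurable_V i).prodMk (hD.measurable_g i))
  have hM : Measurable fun ω i => (D.U i ω, D.V i ω, D.g i ω) := measurable_pi_iff.2 hm
  have hlaw : μ.map (fun ω i => (D.U i ω, D.V i ω, D.g i ω)) =
      ((Measure.infinitePi fun _ : ℕ => unif).prod
        (Measure.infinitePi fun _ : ℕ => fadingLaw)).map (fun p i => (p.1 i, p.2 i)) := by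
    rw [map_prod_infinitePi, hD.mark_iIndep.map_fun_eq_infinitePi_map hm]
    congr 1; ext1 i
    exact hD.mark_law i
  have hjoint := (indepFun_iff_map_prod_eq_prod_map_map hX.aemeasurable hM.aemeasurable).1
    hD.mark_indep
  let f : (ℕ → Plane) × (ℕ → ℝ × ℝ × ℝ) → (ℕ → Plane) × ((ℕ → ℝ) × (ℕ → ℝ × ℝ)) := fun q =>
    (q.1, (fun i => (q.2 i).1, fun i => (q.2 i).2))
  have hf : Measurable f := by fun_prop
  have h1 : {ω | (fun i => D.X i ω, (fun i => D.U i ω, fun i => (D.V i ω, D.g i ω))) ∈ S} =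
      (fun ω => (fun i => D.X i ω, fun i => (D.U i ω, D.V i ω, D.g i ω))) ⁻¹' (f ⁻¹' S) := rfl
  have : IsProbabilityMeasure (μ.map fun ω i => (D.U i ω, D.V i ω, D.g i ω)) :=
    Measure.isProbabilityMeasure_map hM.aemeasurable
  rw [h1, ← Measure.map_apply (hX.prodMk hM) (hS.preimage hf), hjoint,
    Measure.prod_apply (hS.preimage hf),
    lintegral_map (measurable_measure_prodMk_left (hS.preimage hf)) hX]
  refine lintegral_congr fun ω => ?_
  rw [hlaw, Measure.map_apply (by fun_prop) ((hS.preimage hf).preimage (by fun_prop)),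
    Measure.prod_apply (((hS.preimage hf).preimage (by fun_prop)).preimage (by fun_prop))]
  rfl

/-- The Laplace functional of the base stations with their line-of-sight marks. -/
lemma lintegral_infProd (hD : D.IsNetwork lam μ) {h : Plane × ℝ → ℝ≥0∞} (hm : Measurable h)
    (h1 : ∀ a, h a ≤ 1) :
    ∫⁻ ω, ∫⁻ u, infProd (fun i => h (D.X i ω, u i)) ∂(Measure.infinitePi fun _ : ℕ => unif) ∂μ =
      expNeg (ENNReal.ofReal lam * ∫⁻ a, (1 - h a) ∂((volume : Measure Plane).prod unif)) := by
  -- Averaging the marks at fixed positions leaves a product over positions only, to which the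
  -- Poisson Laplace functional applies.
  have h2 : ∀ ω, ∫⁻ u, infProd (fun i => h (D.X i ω, u i))
      ∂(Measure.infinitePi fun _ : ℕ => unif) =
      infProd fun i => ∫⁻ v, h (D.X i ω, v) ∂unif := fun ω =>
    lintegral_infProd_infinitePi unif (f := fun i v => h (D.X i ω, v))
      (fun i => hm.comp (by fun_prop)) (fun i v => h1 _)
  simp only [h2]
  have hle : ∀ x : Plane, ∫⁻ v, h (x, v) ∂unif ≤ 1 := fun x =>
    (lintegral_mono fun v => h1 _).trans (by simp)
  have : SigmaFinite (ENNReal.ofReal lam • (volume : Measure Plane)) :=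
    inferInstanceAs (SigmaFinite (lam.toNNReal • (volume : Measure Plane)))
  rw [hD.poisson.lintegral_infProd (F := fun x => ∫⁻ v, h (x, v) ∂unif)
    hm.lintegral_prod_right' hle, lintegral_smul_measure,
    lintegral_prod (fun a => 1 - h a) (measurable_const.sub hm).aemeasurable, smul_eq_mul]
  congr 2
  refine lintegral_congr fun x => ?_
  have hmx : Measurable fun v => h (x, v) := hm.comp (by fun_prop)
  rw [lintegral_sub hmx (ne_top_of_le_ne_top ENNReal.one_ne_top (hle x))
    (ae_of_all _ fun v => h1 _)]
  simp

variable {m : ℕ} {L : ℝ} (M : PathLoss m L)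

lemma coverage_eq_lintegral (hD : D.IsNetwork lam μ) (P PN q ρ γ : ℝ) :
    D.coverage M μ P PN q ρ γ lam =
      ∫⁻ ω, ∫⁻ u, (Measure.infinitePi fun _ : ℕ => fadingLaw)
        (coverSet P PN γ (activeDensity q ρ lam / lam) (fun i => M.linkGain (D.X i ω, u i))
          (firstMaxIndex fun i => M.linkGain (D.X i ω, u i)))
        ∂(Measure.infinitePi fun _ : ℕ => unif) ∂μ := by
  have hz : ∀ i, Measurable fun a : (ℕ → Plane) × (ℕ → ℝ) => M.linkGain (a.1 i, a.2 i) :=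
    fun i => M.measurable_linkGain.comp (by fun_prop)
  let S : Set ((ℕ → Plane) × ((ℕ → ℝ) × (ℕ → ℝ × ℝ))) :=
    {q' | q'.2.2 ∈ coverSet P PN γ (activeDensity q ρ lam / lam)
      (fun i => M.linkGain (q'.1 i, q'.2.1 i))
      (firstMaxIndex fun i => M.linkGain (q'.1 i, q'.2.1 i))}
  have hS : MeasurableSet S := by
    -- Splitting by the serving index reduces measurability to a fixed `k`.
    have hSk : S = ⋃ k, {q' | (firstMaxIndex fun i => M.linkGain (q'.1 i, q'.2.1 i)) = k} ∩
        {q' | q'.2.2 ∈ coverSet P PN γ (activeDensity q ρ lam / lam)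
          (fun i => M.linkGain (q'.1 i, q'.2.1 i)) k} := by
      ext q'
      simp [S]
    rw [hSk]
    refine MeasurableSet.iUnion fun k => MeasurableSet.inter ?_ ?_
    · have hF : Measurable fun q' : (ℕ → Plane) × ((ℕ → ℝ) × (ℕ → ℝ × ℝ)) =>
          firstMaxIndex fun i => M.linkGain (q'.1 i, q'.2.1 i) :=
        measurable_firstMaxIndex.comp (measurable_pi_iff.2 fun i =>
          M.measurable_linkGain.comp (by fun_prop))
      exact hF (measurableSet_singleton k)
    · exact (measurableSet_coverSet_prod P PN γ (activeDensity q ρ lam / lam) hz k).preimage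
        (f := fun q' : (ℕ → Plane) × ((ℕ → ℝ) × (ℕ → ℝ × ℝ)) => ((q'.1, q'.2.1), q'.2.2))
        (by fun_prop)
  have h := hD.measure_eq_lintegral hS
  have h2 : D.coverage M μ P PN q ρ γ lam =
      μ {ω | (fun i => D.X i ω, (fun i => D.U i ω, fun i => (D.V i ω, D.g i ω))) ∈ S} := rfl
  rw [h2, h]
  rfl

lemma lintegral_interfererFactor (hD : D.IsNetwork lam μ) (hL : 0 < L) {p γ t : ℝ}
    (hp0 : 0 ≤ p) (hp1 : p ≤ 1) (hγ : 0 < γ) (ht : 0 < t) :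
    ∫⁻ ω, ∫⁻ u, infProd (fun i => interfererFactor p γ t (M.linkGain (D.X i ω, u i)))
        ∂(Measure.infinitePi fun _ : ℕ => unif) ∂μ =
      expNeg (ENNReal.ofReal lam * (ENNReal.ofReal p * M.interferenceIntegral γ t)) := by
  have hm : Measurable fun a => interfererFactor p γ t (M.linkGain a) := by
    have := M.measurable_linkGain
    unfold interfererFactor
    fun_prop
  rw [hD.lintegral_infProd (h := fun a => interfererFactor p γ t (M.linkGain a)) hm
    fun a => interfererFactor_le_one hp0 hγ.le ht.le (M.linkGain_pos hL a).le]
  rw [PathLoss.interferenceIntegral,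
    ← lintegral_const_mul' (ENNReal.ofReal p) _ ENNReal.ofReal_ne_top]
  congr 2
  refine lintegral_congr fun a => ?_
  have hz := M.linkGain_pos hL a
  have h0 : 0 ≤ γ * M.linkGain a / (t + γ * M.linkGain a) := by positivity
  have h1 : γ * M.linkGain a / (t + γ * M.linkGain a) ≤ 1 := by
    rw [div_le_one (by positivity)]; linarith
  have h2 : p * (γ * M.linkGain a / (t + γ * M.linkGain a)) ≤ 1 := mul_le_one₀ hp1 h0 h1
  rw [interfererFactor, ← ENNReal.ofReal_one, ← ENNReal.ofReal_sub _ (by linarith),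
    ← ENNReal.ofReal_mul hp0]
  congr 1; ring

/-- A void probability: the product is 1 if no marked station lies in `A`, and 0 otherwise. -/
lemma lintegral_infProd_indicator (hD : D.IsNetwork lam μ) {A : Set (Plane × ℝ)}
    (hA : MeasurableSet A) :
    ∫⁻ ω, ∫⁻ u, infProd (fun i => Aᶜ.indicator 1 (D.X i ω, u i))
        ∂(Measure.infinitePi fun _ : ℕ => unif) ∂μ =
      expNeg (ENNReal.ofReal lam * ((volume : Measure Plane).prod unif) A) := by
  rw [hD.lintegral_infProd (measurable_one.indicator hA.compl)
    fun a => Set.indicator_le_self' (fun _ _ => zero_le) a]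
  congr 2
  rw [← lintegral_indicator_one hA]
  refine lintegral_congr fun a => ?_
  by_cases h : a ∈ A <;> simp [h]

/-- `measure_coverSet_le` with `t = maxGain` applies unless some link exceeds `maxGain`. That event
enters as one minus a void indicator, whose mean is zero because `A` is null. -/
lemma coverage_upper_bound (hD : D.IsNetwork lam μ) (hL : 0 < L) {P PN q ρ γ : ℝ} (hP : 0 < P)
    (hPN : 0 ≤ PN) (hγ : 0 < γ) (hp0 : 0 ≤ activeDensity q ρ lam / lam)
    (hp1 : activeDensity q ρ lam / lam ≤ 1) :
    ENNReal.ofReal (1 - activeDensity q ρ lam / lam * (γ / (1 + γ))) *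
        D.coverage M μ P PN q ρ γ lam ≤
      ENNReal.ofReal (Real.exp (-(PN * γ / (P * M.maxGain)))) *
        expNeg (ENNReal.ofReal lam * (ENNReal.ofReal (activeDensity q ρ lam / lam) *
          M.interferenceIntegral γ M.maxGain)) := by
  rw [hD.coverage_eq_lintegral]
  set p := activeDensity q ρ lam / lam
  have hZ := M.maxGain_pos hL
  set A : Set (Plane × ℝ) := {a | M.maxGain < M.linkGain a} with hAdef
  have hA : MeasurableSet A := measurableSet_lt measurable_const M.measurable_linkGain
  have hA0 : ((volume : Measure Plane).prod unif) A = 0 := by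
    have := M.linkGain_le_maxGain hL
    rw [ae_iff] at this
    simpa [hAdef] using this
  have hnull := hD.lintegral_infProd_indicator hA
  rw [hA0, mul_zero, expNeg_zero] at hnull
  set C := ENNReal.ofReal (1 - p * (γ / (1 + γ))) with hC
  set e := ENNReal.ofReal (Real.exp (-(PN * γ / (P * M.maxGain)))) with he
  have hC1 : C ≤ 1 := by
    rw [hC, ENNReal.ofReal_le_one]
    have : 0 ≤ p * (γ / (1 + γ)) := by positivity
    linarith
  have hpt : ∀ ω (u : ℕ → ℝ), C * (Measure.infinitePi fun _ : ℕ => fadingLaw)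
        (coverSet P PN γ p (fun i => M.linkGain (D.X i ω, u i))
          (firstMaxIndex fun i => M.linkGain (D.X i ω, u i))) ≤
      e * infProd (fun i => interfererFactor p γ M.maxGain (M.linkGain (D.X i ω, u i))) +
        (1 - infProd (fun i => Aᶜ.indicator 1 (D.X i ω, u i))) := by
    intro ω u
    by_cases hall : ∀ i, M.linkGain (D.X i ω, u i) ≤ M.maxGain
    · exact (measure_coverSet_le hP hPN hγ hp0 hp1
        (z := fun i => M.linkGain (D.X i ω, u i)) (fun i => M.linkGain_pos hL _) (hall _)).trans le_self_add
    · push Not at hall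
      obtain ⟨i, hi⟩ := hall
      have h0 : infProd (fun i => Aᶜ.indicator (1 : Plane × ℝ → ℝ≥0∞) (D.X i ω, u i)) = 0 :=
        infProd_eq_zero (i := i) (Set.indicator_of_notMem (by simpa [hAdef] using hi) _)
      rw [h0, tsub_zero]
      exact (mul_le_one' hC1 prob_le_one).trans le_add_self
  have hmF : Measurable fun a => interfererFactor p γ M.maxGain (M.linkGain a) := by
    have := M.measurable_linkGain
    unfold interfererFactor
    fun_prop
  have hm1 := hD.measurable_infProd_mark hmF
  have hm2 := hD.measurable_infProd_mark (measurable_one.indicator hA.compl)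
  rw [← lintegral_const_mul' _ _ ENNReal.ofReal_ne_top]
  refine (lintegral_mono fun ω => (lintegral_const_mul' C _ ENNReal.ofReal_ne_top).symm.le.trans
    (lintegral_mono fun u => hpt ω u)).trans_eq ?_
  rw [lintegral_const_mul_add_one_sub μ (Measure.infinitePi fun _ : ℕ => unif) hm1 hm2
    (fun _ => infProd_le_one _) ENNReal.ofReal_ne_top,
    hD.lintegral_interfererFactor M hL hp0 hp1 hγ hZ, hnull, tsub_self, add_zero]

/-- If the server has gain at least `t`, `le_measure_coverSet` applies. Otherwise no link reaches
`t`, the void indicator equals 1, and it dominates the left side. -/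
lemma coverage_lower_bound (hD : D.IsNetwork lam μ) (hL : 0 < L) {P PN q ρ γ t : ℝ} (hP : 0 < P)
    (hPN : 0 ≤ PN) (hγ : 0 < γ) (hp0 : 0 ≤ activeDensity q ρ lam / lam)
    (hp1 : activeDensity q ρ lam / lam ≤ 1) (ht : 0 < t) :
    ENNReal.ofReal (Real.exp (-(PN * γ / (P * t)))) *
        expNeg (ENNReal.ofReal lam * (ENNReal.ofReal (activeDensity q ρ lam / lam) *
          M.interferenceIntegral γ t)) ≤
      D.coverage M μ P PN q ρ γ lam + expNeg (ENNReal.ofReal lam *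
        ((volume : Measure Plane).prod unif) {a | t ≤ M.linkGain a}) := by
  rw [hD.coverage_eq_lintegral]
  set p := activeDensity q ρ lam / lam
  set A : Set (Plane × ℝ) := {a | t ≤ M.linkGain a} with hAdef
  have hA : MeasurableSet A := measurableSet_le measurable_const M.measurable_linkGain
  set e := ENNReal.ofReal (Real.exp (-(PN * γ / (P * t)))) with he
  have he1 : e ≤ 1 := by
    rw [he, ENNReal.ofReal_le_one, Real.exp_le_one_iff, neg_nonpos]
    positivity
  rw [← hD.lintegral_infProd_indicator hA, ← hD.lintegral_interfererFactor M hL hp0 hp1 hγ ht,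
    ← lintegral_const_mul' _ _ ENNReal.ofReal_ne_top]
  have hm2 := hD.measurable_infProd_mark
    (measurable_one.indicator hA.compl : Measurable (Aᶜ.indicator (1 : Plane × ℝ → ℝ≥0∞)))
  rw [← lintegral_add_right _ hm2.lintegral_prod_right']
  refine lintegral_mono_ae ?_
  filter_upwards [hD.ae_le_firstMaxIndex M hL] with ω hω
  have hm2' := hm2.comp (measurable_prodMk_left (x := ω))
  rw [← lintegral_const_mul' _ _ ENNReal.ofReal_ne_top]
  refine le_trans ?_ (lintegral_add_right _ hm2').le
  refine lintegral_mono fun u => ?_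
  set k := firstMaxIndex fun i => M.linkGain (D.X i ω, u i) with hk
  rcases le_or_gt t (M.linkGain (D.X k ω, u k)) with h | h
  · exact (le_measure_coverSet hP hPN hγ hp0 hp1 (z := fun i => M.linkGain (D.X i ω, u i))
      (fun i => M.linkGain_pos hL _) ht h).trans le_self_add
  · have h0 : infProd (fun i => Aᶜ.indicator (1 : Plane × ℝ → ℝ≥0∞) (D.X i ω, u i)) = 1 := by
      rw [← infProd_one]
      congr 1; ext i
      have : (D.X i ω, u i) ∈ Aᶜ := by
        simpa [hAdef] using (hω u i).trans_lt h
      rw [Set.indicator_of_mem this]; rfl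
    refine (mul_le_one' he1 (infProd_le_one _)).trans ?_
    exact h0.symm.le.trans le_add_self

end Deployment.IsNetwork

/-! ### The limit of infinite density -/

lemma activeDensity_div_mem {q ρ lam : ℝ} (hq : 0 < q) (hρ : 0 < ρ) (hlam : 0 < lam) :
    activeDensity q ρ lam / lam ∈ Set.Icc (0 : ℝ) 1 := by
  have h1 : 1 ≤ (1 + ρ / (q * lam)) ^ q :=
    Real.one_le_rpow (by have : 0 < ρ / (q * lam) := by positivity
                         linarith) hq.le
  have h2 : 1 / (1 + ρ / (q * lam)) ^ q ≤ 1 := by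
    rw [div_le_one (by linarith)]; exact h1
  have h3 : 0 ≤ 1 / (1 + ρ / (q * lam)) ^ q := by positivity
  rw [activeDensity, mul_div_cancel_left₀ _ hlam.ne']
  constructor <;> linarith

/-- The density of the active base stations tends to the density of the users. -/
lemma tendsto_activeDensity {q ρ : ℝ} (hq : 0 < q) :
    Tendsto (activeDensity q ρ) atTop (𝓝 ρ) := by
  -- With `y = 1 / lam`, the active density is the difference quotient at `0` of this function,
  -- whose derivative there is `ρ`.
  have hd : HasDerivAt (fun y : ℝ => -(1 + ρ / q * y) ^ (-q)) ρ 0 := by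
    have h1 : HasDerivAt (fun y : ℝ => 1 + ρ / q * y) (ρ / q) 0 := by
      simpa using ((hasDerivAt_id (0 : ℝ)).const_mul (ρ / q)).const_add 1
    have h2 := (h1.rpow_const (p := -q) (Or.inl (by simp))).neg
    refine h2.congr_deriv ?_
    simp
    field_simp
  have h := hd.tendsto_slope_zero_right.comp tendsto_inv_atTop_nhdsGT_zero
  refine h.congr' ?_
  have hev : ∀ᶠ lam : ℝ in atTop, 0 ≤ 1 + ρ / (q * lam) := by
    have : Tendsto (fun lam : ℝ => 1 + ρ / (q * lam)) atTop (𝓝 (1 + 0)) :=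
      tendsto_const_nhds.add (tendsto_const_nhds.div_atTop (tendsto_id.const_mul_atTop hq))
    simp only [add_zero] at this
    filter_upwards [this.eventually (lt_mem_nhds one_pos)] with lam hlam using hlam.le
  filter_upwards [eventually_gt_atTop (0 : ℝ), hev] with lam hlam hnn
  simp only [Function.comp_apply, smul_eq_mul, zero_add, mul_zero, add_zero, Real.one_rpow, inv_inv]
  rw [activeDensity, one_div, ← Real.rpow_neg hnn,
    show ρ / q * lam⁻¹ = ρ / (q * lam) by field_simp]
  ring

lemma tendsto_coverage {m : ℕ} {L : ℝ} (hL : 0 < L) (M : PathLoss m L) {P PN ρ γ q : ℝ}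
    (hP : 0 < P) (hPN : 0 ≤ PN) (hρ : 0 < ρ) (hγ : 0 < γ) (hq : 0 < q)
    {Ω : ℝ → Type*} [∀ lam, MeasurableSpace (Ω lam)] (μ : ∀ lam, Measure (Ω lam))
    [∀ lam, IsProbabilityMeasure (μ lam)] (D : ∀ lam, Deployment (Ω lam))
    (hD : ∀ lam, 0 < lam → (D lam).IsNetwork lam (μ lam)) :
    Tendsto (fun lam : ℝ => (D lam).coverage M (μ lam) P PN q ρ γ lam) atTop
      (𝓝 (ENNReal.ofReal (Real.exp (-(PN * γ / (P * M.maxGain)))) *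
        expNeg (ENNReal.ofReal ρ * M.interferenceIntegral γ M.maxGain))) := by
  have hZ := M.maxGain_pos hL
  set Z := M.maxGain with hZdef
  have hρ0 : ENNReal.ofReal ρ ≠ 0 := by simpa using hρ
  have had : Tendsto (fun lam => activeDensity q ρ lam) atTop (𝓝 ρ) := tendsto_activeDensity hq
  have hpair : ∀ lam > 0, ∀ J : ℝ≥0∞, ENNReal.ofReal lam *
      (ENNReal.ofReal (activeDensity q ρ lam / lam) * J) =
      ENNReal.ofReal (activeDensity q ρ lam) * J := by
    intro lam hlam J
    rw [← mul_assoc, ← ENNReal.ofReal_mul hlam.le, mul_div_cancel₀ _ hlam.ne']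
  have hbound : ∀ t, Tendsto (fun lam => ENNReal.ofReal (Real.exp (-(PN * γ / (P * t)))) *
      expNeg (ENNReal.ofReal (activeDensity q ρ lam) * M.interferenceIntegral γ t)) atTop
      (𝓝 (ENNReal.ofReal (Real.exp (-(PN * γ / (P * t)))) *
        expNeg (ENNReal.ofReal ρ * M.interferenceIntegral γ t))) := by
    intro t
    refine ENNReal.Tendsto.const_mul ((continuous_expNeg.tendsto _).comp
      (ENNReal.Tendsto.mul_const (ENNReal.tendsto_ofReal had) (Or.inl hρ0)))
      (Or.inr ENNReal.ofReal_ne_top)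
  refine tendsto_order.2 ⟨fun a ha => ?_, fun a ha => ?_⟩
  · have hcont : Tendsto (fun t => ENNReal.ofReal (Real.exp (-(PN * γ / (P * t)))) *
        expNeg (ENNReal.ofReal ρ * (ENNReal.ofReal (Z / t) * M.interferenceIntegral γ Z)))
        (𝓝[<] Z) (𝓝 (ENNReal.ofReal (Real.exp (-(PN * γ / (P * Z)))) *
          expNeg (ENNReal.ofReal ρ * M.interferenceIntegral γ Z))) := by
      refine Tendsto.mono_left ?_ nhdsWithin_le_nhds
      have h1 : Tendsto (fun t => ENNReal.ofReal (Real.exp (-(PN * γ / (P * t))))) (𝓝 Z)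
          (𝓝 (ENNReal.ofReal (Real.exp (-(PN * γ / (P * Z)))))) := by
        refine ENNReal.tendsto_ofReal ((Real.continuous_exp.tendsto _).comp (Tendsto.neg ?_))
        exact tendsto_const_nhds.div (tendsto_const_nhds.mul tendsto_id) (by positivity)
      have h2 : Tendsto (fun t => ENNReal.ofReal (Z / t)) (𝓝 Z) (𝓝 1) := by
        have h3 : Tendsto (fun t => Z / t) (𝓝 Z) (𝓝 (Z / Z)) :=
          tendsto_const_nhds.div tendsto_id hZ.ne'
        rw [div_self hZ.ne'] at h3
        simpa using ENNReal.tendsto_ofReal h3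
      have h4 := ENNReal.Tendsto.mul_const (b := M.interferenceIntegral γ Z) h2
        (Or.inl one_ne_zero)
      rw [one_mul] at h4
      have h5 := (continuous_expNeg.tendsto _).comp
        (ENNReal.Tendsto.const_mul h4 (Or.inr (ENNReal.ofReal_ne_top (r := ρ))))
      exact ENNReal.Tendsto.mul h1 (Or.inr (ne_top_of_le_ne_top ENNReal.one_ne_top
        (expNeg_le_one _))) h5 (Or.inr ENNReal.ofReal_ne_top)
    -- Here `t` is fixed in terms of `a` alone, before `lam` grows.
    obtain ⟨t, hta, htZ, ht0⟩ := ((hcont.eventually (lt_mem_nhds ha)).and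
      ((eventually_mem_nhdsWithin (a := Z) (s := Set.Iio Z)).and
        (nhdsWithin_le_nhds (lt_mem_nhds hZ)))).exists
    have hta' : a < ENNReal.ofReal (Real.exp (-(PN * γ / (P * t)))) *
        expNeg (ENNReal.ofReal ρ * M.interferenceIntegral γ t) :=
      hta.trans_le (mul_le_mul_right (expNeg_antitone (mul_le_mul_right
        (M.interferenceIntegral_le hL hγ ht0 (le_of_lt htZ)) _)) _)
    -- As `t < Z`, the set has positive measure, so the exponent tends to infinity.
    have hvoid : Tendsto (fun lam => expNeg (ENNReal.ofReal lam *
        ((volume : Measure Plane).prod unif) {a | t ≤ M.linkGain a})) atTop (𝓝 0) := by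
      rw [← expNeg_top]
      refine (continuous_expNeg.tendsto _).comp ?_
      have h := ENNReal.Tendsto.mul_const
        (b := ((volume : Measure Plane).prod unif) {a | t ≤ M.linkGain a})
        ENNReal.tendsto_ofReal_atTop (Or.inl ENNReal.top_ne_zero)
      rwa [ENNReal.top_mul (M.measure_le_linkGain_ne_zero hL htZ)] at h
    have hlim := ENNReal.Tendsto.sub (hbound t) hvoid (Or.inr ENNReal.zero_ne_top)
    rw [tsub_zero] at hlim
    filter_upwards [hlim.eventually (lt_mem_nhds hta'), eventually_gt_atTop 0] with lam h1 hlam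
    obtain ⟨hp0, hp1⟩ := activeDensity_div_mem hq hρ hlam
    have h2 := (hD lam hlam).coverage_lower_bound M hL hP hPN hγ hp0 hp1 ht0
    rw [hpair lam hlam] at h2
    exact h1.trans_le (tsub_le_iff_right.2 h2)
  -- The active density stays bounded, so the activity probability vanishes and the correction
  -- constant tends to 1.
  · have hp : Tendsto (fun lam => activeDensity q ρ lam / lam) atTop (𝓝 0) :=
      had.div_atTop tendsto_id
    have hC : Tendsto (fun lam => ENNReal.ofReal
        (1 - activeDensity q ρ lam / lam * (γ / (1 + γ)))) atTop (𝓝 1) := by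
      simpa using ENNReal.tendsto_ofReal
        ((tendsto_const_nhds (x := (1 : ℝ))).sub (hp.mul_const (γ / (1 + γ))))
    have hlim := ENNReal.Tendsto.div (hbound Z) (Or.inr one_ne_zero) hC
      (Or.inl ENNReal.one_ne_top)
    rw [div_one] at hlim
    filter_upwards [hlim.eventually (gt_mem_nhds ha), eventually_gt_atTop 0,
      hC.eventually (lt_mem_nhds one_pos)] with lam h1 hlam hC0
    obtain ⟨hp0, hp1⟩ := activeDensity_div_mem hq hρ hlam
    have h2 := (hD lam hlam).coverage_upper_bound M hL hP hPN hγ hp0 hp1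
    rw [hpair lam hlam] at h2
    refine lt_of_le_of_lt ?_ h1
    rw [ENNReal.le_div_iff_mul_le (Or.inl hC0.ne') (Or.inl ENNReal.ofReal_ne_top), mul_comm]
    exact h2

end CellularNetwork

end

theorem theorem2 {m : ℕ} {L : ℝ} (hL : 0 < L) (M : CellularNetwork.PathLoss m L)
    (P PN ρ γ : ℝ) (hP : 0 < P) (hPN : 0 ≤ PN) (hρ : 0 < ρ) (hγ : 0 < γ) :
    ∃ c : ℝ≥0∞,
      (∀ (q : ℝ), 0 < q →
        ∀ (Ω : ℝ → Type*) [∀ lam, MeasurableSpace (Ω lam)]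
          (μ : ∀ lam, Measure (Ω lam)) [∀ lam, IsProbabilityMeasure (μ lam)]
          (D : ∀ lam, CellularNetwork.Deployment (Ω lam)),
          (∀ lam, 0 < lam → (D lam).IsNetwork lam (μ lam)) →
          Tendsto (fun lam : ℝ => (D lam).coverage M (μ lam) P PN q ρ γ lam) atTop (𝓝 c)) ∧
      ((∃ w, L < w ∧ CellularNetwork.pieceIndex M.d w = 0 ∧ 0 < M.prL 0 w) →
        (∀ w, L ≤ w → M.gainLoS w ≤ M.pieceLoS 0 L ∧ M.gainNLoS w ≤ M.pieceLoS 0 L) →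
        c = M.coverageLimit P PN ρ γ) :=
  -- The witness is the limit in `tendsto_coverage`, which involves neither `q` nor the probability
  -- spaces.
  ⟨_, fun _ hq _ _ μ _ D hD => CellularNetwork.tendsto_coverage hL M hP hPN hρ hγ hq μ D hD,
    fun h1 h2 => (M.coverageLimit_eq hL hP hρ hγ (M.maxGain_eq hL h1 h2)).symm⟩
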